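/- Conventions: $[x,y]=x^{-1}y^{-1}xy$ and commutators are left-normed; a group is $3$-Engel if $[y,x,x,x]=1$ for all $x,y$; it is metabelian if $G''=1$; $G^k$ is the subgroup generated by all $k$-th powers; a finite $p$-group $G$ is powerful if $[G,G]\le G^p$ when $p$ is odd and $[G,G]\le G^4$ when $p=2$; the rank of such a group is its minimal number of generators. Theorem. Let $p$ be a prime, let $r\ge 3$, and let $G$ be a powerful (in particular finite) metabelian $3$-Engel $p$-group of rank $r$. If $p$ is odd, then $G$ is nilpotent of class at most $3$. If $p=2$, then $G$ is nilpotent of class at most $4$. These bounds are best possible: for every odd prime $p$ and every $r\ge 3$ there is a powerful metabelian $3$-Engel $p$-group of rank $r$ and nilpotency class exactly $3$, and for every $r\ge 3$ there is a powerful metabelian $3$-Engel $2$-group of rank $r$ and nilpotency class exactly $4$. Moreover, the group $\langle a,b,c\rangle$ with defining relations $$[a,b]=a^{-2^5},\quad [a,c]=b^{3\cdot 2^6}a^{2^4},\quad [b,c]=b^{2^7}a^{2^2},$$ $$[a^{2^2},b^{2^6}]=1,\quad [a^{2^2},b]=a^{-2^7},\quad [a^{2^2},c]=a^{-2^2}b^{3\cdot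 2^8}a^{17\cdot 2^2},$$ $$[b^{2^6},a]=a^{2^{11}},\quad [b^{2^6},c]=a^{2^8},\quad a^{2^{12}}=b^{2^{11}}=c^{2^{10}}=1$$ is a powerful metabelian $3$-Engel $2$-group of rank $3$ and nilpotency class $4$. -/

import Mathlib

universe u

namespace PowerfulEngel

/-- The commutator `[x, y] = x⁻¹ y⁻¹ x y`. Mathlib's `⁅x, y⁆` is `x y x⁻¹ y⁻¹`; the convention
matters for the explicit presentation below. -/
def comm {G : Type*} [Group G] (x y : G) : G := x⁻¹ * y⁻¹ * x * y

/-- `G` is an `n`-Engel group: `[y, x, …, x] = 1` with `n` entries `x`, for all `x, y`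
(left-normed commutators). -/
def IsEngel (n : ℕ) (G : Type*) [Group G] : Prop :=
  ∀ x y : G, (fun z => comm z x)^[n] y = 1

/-- `G ^ k`: the subgroup generated by all `k`-th powers of elements of `G`. -/
def powerSubgroup (G : Type*) [Group G] (k : ℕ) : Subgroup G :=
  Subgroup.closure (Set.range fun g : G => g ^ k)

/-- A finite `p`-group is powerful: `[G, G] ≤ G ^ p` if `p` is odd, `[G, G] ≤ G ^ 4` if `p = 2`.
(Finiteness is carried by the instance.) -/
structure IsPowerful (p : ℕ) (G : Type*) [Group G] [Finite G] : Prop where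
  isPGroup : IsPGroup p G
  commutator_le : commutator G ≤ powerSubgroup G (if p = 2 then 4 else p)

/-- The second derived subgroup is trivial. -/
def IsMetabelian (G : Type*) [Group G] : Prop := derivedSeries G 2 = ⊥

/-- `G` is a powerful metabelian `3`-Engel `p`-group of rank `r`; the rank is the minimal number
of generators. -/
structure IsPowerfulMetabelianThreeEngel (p r : ℕ) (G : Type*) [Group G] [Finite G] : Prop where
  powerful : IsPowerful p G
  metabelian : IsMetabelian G
  engel : IsEngel 3 G
  rank_eq : Group.rank G = r

/-- `G` is nilpotent of class at most `c`. -/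
def ClassAtMost (c : ℕ) (G : Type*) [Group G] : Prop :=
  Group.IsNilpotent G ∧ Group.nilpotencyClass G ≤ c

/-- `G` is nilpotent of class exactly `c`. -/
def ClassEq (c : ℕ) (G : Type*) [Group G] : Prop :=
  Group.IsNilpotent G ∧ Group.nilpotencyClass G = c

/-- The first free generator. -/
def genA : FreeGroup (Fin 3) := FreeGroup.of 0
/-- The second free generator. -/
def genB : FreeGroup (Fin 3) := FreeGroup.of 1
/-- The third free generator. -/
def genC : FreeGroup (Fin 3) := FreeGroup.of 2

/-- The relators of the explicit `2`-group; a relation `u = v` is given by the relator `u v⁻¹`. -/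
def exampleRels : Set (FreeGroup (Fin 3)) :=
  { comm genA genB * ((genA ^ 2 ^ 5)⁻¹)⁻¹,
    comm genA genC * (genB ^ (3 * 2 ^ 6) * genA ^ 2 ^ 4)⁻¹,
    comm genB genC * (genB ^ 2 ^ 7 * genA ^ 2 ^ 2)⁻¹,
    comm (genA ^ 2 ^ 2) (genB ^ 2 ^ 6),
    comm (genA ^ 2 ^ 2) genB * ((genA ^ 2 ^ 7)⁻¹)⁻¹,
    comm (genA ^ 2 ^ 2) genC *
      ((genA ^ 2 ^ 2)⁻¹ * genB ^ (3 * 2 ^ 8) * genA ^ (17 * 2 ^ 2))⁻¹,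
    comm (genB ^ 2 ^ 6) genA * (genA ^ 2 ^ 11)⁻¹,
    comm (genB ^ 2 ^ 6) genC * (genA ^ 2 ^ 8)⁻¹,
    genA ^ 2 ^ 12,
    genB ^ 2 ^ 11,
    genC ^ 2 ^ 10 }

/-- The group with three generators and the relators `exampleRels`. -/
abbrev ExampleGroup : Type := PresentedGroup exampleRels

end PowerfulEngel

/-! Upper bounds. Since `G''= 1`, the derived subgroup, written additively, is a module `M` over the
commutative ring `R` generated by the conjugations, and commuting with `x` is multiplication by `X =
t x - 1`. The Engel law reads `X² [y,x] = 0`. Polarising it gives, modulo weight 5, `2 (BC [y,a] +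
AC [y,b] + AB [y,c]) = 0`; together with the Jacobi identity this yields `8 XY [a,b] = 0` modulo
weight 5 (`eight_smul_mem`). In a finite `p`-group, `p` and all `X` lie in the Jacobson radical of
`R`, so Nakayama's lemma applies. For odd `p`, 8 is invertible modulo `p` and the weight-4 submodule
vanishes.

For `p = 2`, `[g⁴,x] = (4 + 6 (t g - 1)) [g,x]`, so with a fourth power in the first slot the
polarised identity gains a factor 2 inside weight 5. By powerfulness the first slot may be a
commutator `[a,b]`; the cyclic sum is then `3 XYZ [a,b]`, and as 3 is odd the weight-5 submodule
vanishes (`weightFive_eq_bot`).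

Sharpness. For odd `p`, take `ZMod (p^3)` extended by the automorphism `1 + p`: each further
commutator contributes a factor `p`. For `p = 2`, take the presented group. Its derived subgroup
lies in the abelian normal subgroup generated by `u = a⁴` and `v = b⁶⁴`, on which every `t g - 1`
squares to zero while `(t b - 1)(t c - 1)` sends `u` to `u^512 = a^(2^11)`. That this element is not
1 is seen in a matrix representation. Larger ranks come from elementary abelian direct factors. -/

namespace PowerfulEngel

open scoped commutatorElement

/-! ### The linearised Engel identity and Nakayama's lemma -/

/-- The module data carried by the derived subgroup of a metabelian `3`-Engel group: `t g` is
conjugation by `g`, and `d x y` is the commutator of `x` and `y`, written additively. -/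
structure IsEngelAction {R M G : Type*} [CommRing R] [AddCommGroup M] [Module R M] [Group G]
    (t : G →* R) (d : G → G → M) : Prop where
  mul_left : ∀ x y z, d (x * y) z = t y • d x z + d y z
  swap : ∀ x y, d y x = -d x y
  comm_left : ∀ x y z, d (comm x y) z = (t z - 1) • d x y
  engel : ∀ x y, (t x - 1) ^ 2 • d y x = 0

namespace IsEngelAction

variable {R M G : Type*} [CommRing R] [AddCommGroup M] [Module R M] [Group G]
  {t : G →* R} {d : G → G → M}

theorem map_comm (t : G →* R) (x y : G) : t (comm x y) = 1 := by
  have hx : t x⁻¹ * t x = 1 := by rw [← map_mul]; simp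
  have hy : t y⁻¹ * t y = 1 := by rw [← map_mul]; simp
  simp only [comm, map_mul]
  linear_combination (t y⁻¹ * t y) * hx + hy

theorem mul_right (h : IsEngelAction t d) (x y z : G) :
    d x (y * z) = t z • d x y + d x z := by
  rw [h.swap (y * z) x, h.mul_left, h.swap y x, h.swap z x]
  module

/-- Expand `d (x * y) z` directly and again through `x * y = y * x * comm x y`; the commutator
factor acts trivially. -/
theorem jacobi (h : IsEngelAction t d) (x y z : G) :
    (t z - 1) • d x y = (t y - 1) • d x z - (t x - 1) • d y z := by
  have e : x * y = y * x * comm x y := by simp [comm, mul_assoc]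
  have h1 := h.mul_left x y z
  rw [e, h.mul_left, h.mul_left, map_comm, h.comm_left] at h1
  linear_combination (norm := module) h1

variable (t) in
/-- The ideal generated by `p` and the augmentation ideal. -/
def augIdeal (p : ℕ) : Ideal R := Ideal.span (insert (p : R) (Set.range fun g => t g - 1))

variable (t d) in
/-- The submodule spanned by the left-normed commutators of weight `4`. -/
def weightFour : Submodule R M :=
  Submodule.span R {m | ∃ a b x y, m = ((t x - 1) * (t y - 1)) • d a b}

variable (t d) in
/-- The submodule spanned by the left-normed commutators of weight `5`. -/
def weightFive : Submodule R M :=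
  Submodule.span R {m | ∃ a b x y z, m = ((t x - 1) * (t y - 1) * (t z - 1)) • d a b}

theorem natCast_mem_augIdeal (p : ℕ) : (p : R) ∈ augIdeal t p :=
  Ideal.subset_span (Set.mem_insert _ _)

theorem sub_one_mem_augIdeal (p : ℕ) (g : G) : t g - 1 ∈ augIdeal t p :=
  Ideal.subset_span (Set.mem_insert_of_mem _ ⟨g, rfl⟩)

theorem mem_weightFour (x y a b : G) : ((t x - 1) * (t y - 1)) • d a b ∈ weightFour t d :=
  Submodule.subset_span ⟨a, b, x, y, rfl⟩

theorem mem_weightFive (x y z a b : G) :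
    ((t x - 1) * (t y - 1) * (t z - 1)) • d a b ∈ weightFive t d :=
  Submodule.subset_span ⟨a, b, x, y, z, rfl⟩

theorem smul_mem_weightFive (x y z a b : G) (r : R) :
    (r * ((t x - 1) * (t y - 1) * (t z - 1))) • d a b ∈ weightFive t d := by
  rw [mul_smul]
  exact Submodule.smul_mem _ r (mem_weightFive x y z a b)

theorem weightFive_le (p : ℕ) : weightFive t d ≤ augIdeal t p • weightFour t d := by
  refine Submodule.span_le.2 ?_
  rintro _ ⟨a, b, x, y, z, rfl⟩
  rw [mul_assoc, mul_smul]
  exact Submodule.smul_mem_smul (sub_one_mem_augIdeal p x) (mem_weightFour y z a b)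

/-- All generators are nilpotent: modulo `p`, the `p ^ k`-th power of `t g - 1` is `t g ^ p ^ k - 1
= 0`. -/
theorem augIdeal_le_jacobson {p : ℕ} [hp : Fact p.Prime] (hnil : IsNilpotent (p : R))
    (htor : ∀ g, ∃ k, t g ^ p ^ k = 1) : augIdeal t p ≤ Ideal.jacobson ⊥ := by
  refine le_trans ?_ (Ideal.radical_le_jacobson (I := ⊥))
  refine Ideal.span_le.2 (Set.insert_subset hnil ?_)
  rintro _ ⟨g, rfl⟩
  obtain ⟨k, hk⟩ := htor g
  obtain ⟨r, hr⟩ := exists_add_pow_prime_pow_eq hp.out (t g - 1) 1 k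
  rw [sub_add_cancel, hk, one_pow] at hr
  have hr' : (t g - 1) ^ p ^ k = p * -((t g - 1) * r) := by linear_combination -hr
  have : IsNilpotent ((t g - 1) ^ p ^ k) := by
    rw [hr']
    exact (Commute.all _ _).isNilpotent_mul_right hnil
  exact this.of_pow

/-- The Engel identity, linearised in two variables. -/
theorem engel_two (h : IsEngelAction t d) (y a b : G) :
    ((t a - 1) ^ 2) • d y b + (2 * (t a - 1) * (t b - 1)) • d y b + ((t b - 1) ^ 2) • d y a +
      (2 * (t a - 1) * (t b - 1)) • d y a ∈ weightFive t d := by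
  have h1 := h.engel (a * b) y
  rw [h.mul_right, map_mul] at h1
  have ha := h.engel a y
  have hb := h.engel b y
  have m1 := smul_mem_weightFive (t := t) (d := d) a a b y b 2
  have m2 := smul_mem_weightFive (t := t) (d := d) a b b y a (4 + 2 * (t b - 1))
  have m3 := smul_mem_weightFive (t := t) (d := d) b b b y a 1
  have := neg_mem (add_mem (add_mem m1 m2) m3)
  convert this using 1
  -- With `A = t a - 1` and `B = t b - 1`, the factor `t a * t b - 1` is both `t b * A + B` and `t a
  -- * B + A`; the two subtracted terms remove the pure squares `A² d y a` and `B² d y b`.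
  linear_combination (norm := module) h1 - (t b) ^ 3 • ha - (t a) ^ 2 • hb

/-- The full linearisation of the Engel identity. -/
theorem engel_three (h : IsEngelAction t d) (y a b c : G) :
    (2 * ((t b - 1) * (t c - 1))) • d y a + (2 * ((t a - 1) * (t c - 1))) • d y b +
      (2 * ((t a - 1) * (t b - 1))) • d y c ∈ weightFive t d := by
  -- Polarise once more: the instance at `a * c` minus those at `a` and at `c`.
  have h1 := h.engel_two y (a * c) b
  have h2 := h.engel_two y a b
  have h3 := h.engel_two y c b
  rw [h.mul_right, map_mul] at h1
  have m1 := smul_mem_weightFive (t := t) (d := d) a a c y b 2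
  have m2 := smul_mem_weightFive (t := t) (d := d) a c c y b (2 + (t a - 1))
  have m3 := smul_mem_weightFive (t := t) (d := d) a c b y b 2
  have m4 := smul_mem_weightFive (t := t) (d := d) c b b y a 1
  have m5 := smul_mem_weightFive (t := t) (d := d) a c b y a (2 + 2 * t c)
  have m6 := smul_mem_weightFive (t := t) (d := d) c c b y a 2
  have m7 := smul_mem_weightFive (t := t) (d := d) a c b y c 2
  have := sub_mem (sub_mem (sub_mem h1 h2) h3)
    (add_mem (add_mem (add_mem m1 m2) (add_mem m3 m4)) (add_mem (add_mem m5 m6) m7))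
  convert this using 1
  module

/-- Antisymmetrise `engel_three` in `a` and `b`. The terms in `d a b` give 4, and the Jacobi
identity turns each of the two remaining pairs into another 2. -/
theorem eight_smul_mem (h : IsEngelAction t d) (x y a b : G) :
    (8 * ((t x - 1) * (t y - 1))) • d a b ∈ weightFive t d := by
  have h1 := h.engel_three a b x y
  have h2 := h.engel_three b a x y
  have j1 := h.jacobi a x b
  have j2 := h.jacobi a y b
  have hs := h.swap a b
  convert sub_mem h1 h2 using 1
  have hx := h.swap x b
  have hy := h.swap y b
  rw [hs, hx, hy]
  linear_combination (norm := module)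
    -(2 * (t y - 1)) • j1 - (2 * (t x - 1)) • j2

/-- Nakayama's lemma; finite generation comes from finiteness of `M`. -/
theorem eq_bot_of_le_augIdeal_smul [Finite M] {p : ℕ} [Fact p.Prime] (hnil : IsNilpotent (p : R))
    (htor : ∀ g, ∃ k, t g ^ p ^ k = 1) {N : Submodule R M} (hN : N ≤ augIdeal t p • N) :
    N = ⊥ :=
  have : N.FG := (Module.Finite.iff_fg (N := N)).1 inferInstance
  Submodule.eq_bot_of_le_smul_of_le_jacobson_bot _ _ this hN (augIdeal_le_jacobson hnil htor)

/-- A Bézout relation `8 u + p v = 1` splits each generator into a part of weight 5 and a multiple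
of `p`, both in `augIdeal • weightFour`. -/
theorem weightFour_eq_bot (h : IsEngelAction t d) [Finite M] {p : ℕ} [hp : Fact p.Prime]
    (hodd : Odd p) (hnil : IsNilpotent (p : R)) (htor : ∀ g, ∃ k, t g ^ p ^ k = 1) :
    weightFour t d = ⊥ := by
  refine eq_bot_of_le_augIdeal_smul hnil htor ?_
  refine Submodule.span_le.2 ?_
  rintro _ ⟨a, b, x, y, rfl⟩
  have hc : Nat.Coprime 8 p := Nat.Coprime.pow_left 3 (Nat.coprime_two_left.2 hodd)
  obtain ⟨u, v, huv⟩ := (Nat.isCoprime_iff_coprime.2 hc)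
  have huv' : (u : R) * 8 + v * p = 1 := by exact_mod_cast congrArg (Int.cast : ℤ → R) huv
  have h1 := Submodule.smul_mem _ (u : R) (weightFive_le p (h.eight_smul_mem x y a b))
  have h2 := Submodule.smul_mem _ (v : R) (Submodule.smul_mem_smul
    (natCast_mem_augIdeal (t := t) p) (mem_weightFour (t := t) (d := d) x y a b))
  suffices h3 : ((t x - 1) * (t y - 1)) • d a b =
      (u : R) • (8 * ((t x - 1) * (t y - 1))) • d a b +
        (v : R) • (p : R) • ((t x - 1) * (t y - 1)) • d a b from h3 ▸ add_mem h1 h2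
  rw [smul_smul, smul_smul, smul_smul, ← add_smul]
  refine congrArg (· • d a b) ?_
  linear_combination -((t x - 1) * (t y - 1)) * huv'

theorem one_left (h : IsEngelAction t d) (x : G) : d 1 x = 0 := by
  simpa using h.mul_left 1 1 x

/-- With `T = t g - 1`, the sum `1 + t g + t g² + t g³` is `4 + 6T + 4T² + T³`, and `T²` kills `d g
x`. -/
theorem pow_four_left (h : IsEngelAction t d) (g x : G) :
    d (g ^ 4) x = (4 + 6 * (t g - 1)) • d g x := by
  have h1 := h.engel g x
  rw [h.swap g x, smul_neg, neg_eq_zero] at h1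
  rw [pow_succ, pow_succ, pow_succ, pow_one, h.mul_left, h.mul_left, h.mul_left]
  linear_combination (norm := module) (t g + 3) • h1

/-- The sum over the three choices of the entry following `n` in `[n, x, y, z]`. -/
theorem cyclic_sum_mem (h : IsEngelAction t d) (x y z : G) {n : G}
    (hn : n ∈ powerSubgroup G 4) :
    ((t y - 1) * (t z - 1)) • d n x + ((t x - 1) * (t z - 1)) • d n y +
      ((t x - 1) * (t y - 1)) • d n z ∈ augIdeal t 2 • weightFive t d := by
  induction hn using Subgroup.closure_induction with
  | mem _ hg =>
    obtain ⟨g, rfl⟩ := hg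
    have two : (2 : R) ∈ augIdeal t 2 := by exact_mod_cast natCast_mem_augIdeal (t := t) 2
    -- In `4 + 6 (t g - 1)` the 4 is twice the factor 2 of `engel_three`, and the 6 is twice 3 on
    -- terms already of weight 5.
    have m0 := Submodule.smul_mem_smul two (h.engel_three g x y z)
    have m1 := Submodule.smul_mem_smul two (smul_mem_weightFive (t := t) (d := d) g y z g x 3)
    have m2 := Submodule.smul_mem_smul two (smul_mem_weightFive (t := t) (d := d) g x z g y 3)
    have m3 := Submodule.smul_mem_smul two (smul_mem_weightFive (t := t) (d := d) g x y g z 3)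
    have := add_mem m0 (add_mem m1 (add_mem m2 m3))
    simp only [h.pow_four_left]
    convert this using 1
    module
  | one => simp [h.one_left]
  | mul a b _ _ ha hb =>
    convert add_mem (Submodule.smul_mem _ (t b) ha) hb using 1
    simp only [h.mul_left]
    module
  | inv a _ ha =>
    have e : ∀ w, d a⁻¹ w = -(t a⁻¹ • d a w) := fun w => by
      rw [eq_neg_iff_add_eq_zero, add_comm, ← h.mul_left, mul_inv_cancel, h.one_left]
    convert neg_mem (Submodule.smul_mem _ (t a⁻¹) ha) using 1
    simp only [e]
    module

/-- For `n = comm a b` all three terms of the cyclic sum equal the same weight-5 generator. Three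
times it minus twice it puts the generator in `augIdeal • weightFive`. -/
theorem weightFive_eq_bot (h : IsEngelAction t d) [Finite M] (hnil : IsNilpotent ((2 : ℕ) : R))
    (htor : ∀ g, ∃ k, t g ^ 2 ^ k = 1) (hpow : ∀ x y : G, comm x y ∈ powerSubgroup G 4) :
    weightFive t d = ⊥ := by
  have : Fact (Nat.Prime 2) := ⟨Nat.prime_two⟩
  refine eq_bot_of_le_augIdeal_smul (p := 2) hnil htor ?_
  refine Submodule.span_le.2 ?_
  rintro _ ⟨a, b, x, y, z, rfl⟩
  have two : (2 : R) ∈ augIdeal t 2 := by exact_mod_cast natCast_mem_augIdeal (t := t) 2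
  have m := h.cyclic_sum_mem x y z (hpow a b)
  simp only [h.comm_left] at m
  have m' := Submodule.smul_mem_smul two (mem_weightFive (t := t) (d := d) x y z a b)
  suffices e : ((t x - 1) * (t y - 1) * (t z - 1)) • d a b =
      ((t y - 1) * (t z - 1)) • (t x - 1) • d a b + ((t x - 1) * (t z - 1)) • (t y - 1) • d a b +
        ((t x - 1) * (t y - 1)) • (t z - 1) • d a b -
      (2 : R) • ((t x - 1) * (t y - 1) * (t z - 1)) • d a b from e ▸ sub_mem m m'
  module

end IsEngelAction

/-! ### The derived subgroup as a module over the ring of conjugations -/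

open scoped IsMulCommutative in
/-- Conjugation by `g` on the derived subgroup, as an additive endomorphism. -/
def conjEnd (G : Type*) [Group G] [IsMulCommutative (commutator G)] (g : G) :
    AddMonoid.End (Additive (commutator G)) :=
  MonoidHom.toAdditive (MulAut.conjNormal (H := commutator G) g⁻¹).toMonoidHom

section
variable {G : Type*} [Group G] [IsMulCommutative (commutator G)]

open scoped IsMulCommutative

theorem conjEnd_apply (g : G) (m : Additive (commutator G)) :
    ((conjEnd G g m).toMul : G) = g⁻¹ * m.toMul * g := by
  change ((MulAut.conjNormal (H := commutator G) g⁻¹ m.toMul : commutator G) : G) = _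
  rw [MulAut.conjNormal_apply, inv_inv]

theorem comm_mem_commutator {G : Type*} [Group G] (x y : G) : comm x y ∈ commutator G := by
  have := Subgroup.commutator_mem_commutator (Subgroup.mem_top x⁻¹) (Subgroup.mem_top y⁻¹)
  rwa [commutatorElement_def, inv_inv, inv_inv] at this

theorem commutator_mul_comm {m n : G} (hm : m ∈ commutator G) (hn : n ∈ commutator G) :
    m * n = n * m :=
  congrArg Subtype.val (mul_comm (⟨m, hm⟩ : commutator G) ⟨n, hn⟩)

theorem additive_ext {G : Type*} [Group G] {m n : Additive (commutator G)}
    (h : (m.toMul : G) = n.toMul) : m = n :=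
  Additive.toMul.injective (Subtype.ext h)

theorem end_ext {G : Type*} [Group G] {f g : AddMonoid.End (Additive (commutator G))}
    (h : ∀ m, ((f m).toMul : G) = (g m).toMul) : f = g :=
  AddMonoidHom.ext fun m => additive_ext (h m)

theorem conjEnd_mul_rev (g h : G) : conjEnd G (h * g) = conjEnd G g * conjEnd G h := by
  refine end_ext fun m => ?_
  change _ = ((conjEnd G g (conjEnd G h m)).toMul : G)
  rw [conjEnd_apply, conjEnd_apply, conjEnd_apply]
  group

/-- `g * h` and `h * g` differ by a commutator, which centralises the abelian derived subgroup.
Hence the anti-homomorphism `conjEnd` is also a homomorphism. -/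
theorem conjEnd_mul_comm (g h : G) : conjEnd G (g * h) = conjEnd G (h * g) := by
  refine end_ext fun m => ?_
  rw [conjEnd_apply, conjEnd_apply]
  have e : g * h = h * g * comm g h := by simp [comm, mul_assoc]
  have hn : (h * g)⁻¹ * (m.toMul : G) * (h * g) ∈ commutator G := by
    simpa using (inferInstance : (commutator G).Normal).conj_mem _ m.toMul.2 (h * g)⁻¹
  have := commutator_mul_comm hn (comm_mem_commutator g h)
  rw [e]
  calc _ = (comm g h)⁻¹ * ((h * g)⁻¹ * (m.toMul : G) * (h * g) * comm g h) := by group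
    _ = _ := by rw [this]; group

theorem conjEnd_mul (g h : G) : conjEnd G (g * h) = conjEnd G g * conjEnd G h := by
  rw [conjEnd_mul_comm, conjEnd_mul_rev]

theorem conjEnd_one : conjEnd G 1 = 1 := by
  refine end_ext fun m => ?_
  rw [conjEnd_apply]
  simp

variable (G) in
/-- The ring of endomorphisms of the derived subgroup generated by the conjugations. -/
abbrev ConjRing : Subring (AddMonoid.End (Additive (commutator G))) :=
  Subring.closure (Set.range (conjEnd G))

instance : IsMulCommutative (ConjRing G) :=
  Subring.isMulCommutative_closure <| by
    rintro _ ⟨x, rfl⟩ _ ⟨y, rfl⟩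
    rw [← conjEnd_mul, ← conjEnd_mul, conjEnd_mul_comm]

variable (G) in
/-- Conjugation on the derived subgroup, as a homomorphism into a commutative ring. -/
def conjHom : G →* ConjRing G where
  toFun g := ⟨conjEnd G g, Subring.subset_closure ⟨g, rfl⟩⟩
  map_one' := Subtype.ext conjEnd_one
  map_mul' g h := Subtype.ext (conjEnd_mul g h)

/-- The commutator of two elements, as an element of the additive derived subgroup. -/
def commAdd (x y : G) : Additive (commutator G) :=
  Additive.ofMul ⟨comm x y, comm_mem_commutator x y⟩

theorem toMul_conjHom_smul (g : G) (m : Additive (commutator G)) :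
    ((conjHom G g • m).toMul : G) = g⁻¹ * m.toMul * g := conjEnd_apply g m

theorem toMul_conjHom_sub_one_smul (g : G) (m : Additive (commutator G)) :
    (((conjHom G g - 1) • m).toMul : G) = comm (m.toMul : G) g := by
  rw [sub_smul, one_smul, sub_eq_neg_add, toMul_add, Subgroup.coe_mul, toMul_conjHom_smul,
    toMul_neg, Subgroup.coe_inv]
  simp [comm, mul_assoc]

theorem isEngelAction (h : IsEngel 3 G) : IsEngelAction (conjHom G) (commAdd (G := G)) where
  mul_left x y z := by
    apply additive_ext
    rw [toMul_add, Subgroup.coe_mul, toMul_conjHom_smul]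
    simp [commAdd, comm, mul_assoc]
  swap x y := by
    apply additive_ext
    simp [commAdd, comm, mul_assoc]
  comm_left x y z := additive_ext (toMul_conjHom_sub_one_smul z (commAdd x y)).symm
  engel x y := by
    apply additive_ext
    rw [pow_two, mul_smul, toMul_conjHom_sub_one_smul, toMul_conjHom_sub_one_smul]
    exact h x y

theorem isNilpotent_natCast_conjRing [Finite G] {p : ℕ} [Fact p.Prime] (h : IsPGroup p G) :
    IsNilpotent (p : ConjRing G) := by
  obtain ⟨n, hn⟩ := IsPGroup.iff_card.1 h
  refine ⟨n, Subtype.ext (end_ext fun m => ?_)⟩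
  have e : (((p : ConjRing G) ^ n : ConjRing G) : AddMonoid.End (Additive (commutator G))) m =
      p ^ n • m := by
    have : ((p : ConjRing G) ^ n) • m = (p ^ n) • m := by
      rw [← Nat.cast_pow, Nat.cast_smul_eq_nsmul]
    exact this
  rw [e, toMul_nsmul, Subgroup.coe_pow, ← hn, pow_card_eq_one']
  rfl

theorem exists_conjHom_pow_eq_one {p : ℕ} (h : IsPGroup p G) (g : G) :
    ∃ k, conjHom G g ^ p ^ k = 1 := by
  obtain ⟨k, hk⟩ := h g
  exact ⟨k, by rw [← map_pow, hk, map_one]⟩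

/-- A linear relation on the derived subgroup holds as soon as it holds on commutators. -/
theorem smul_eq_zero_of_forall_commAdd {r : ConjRing G} (h : ∀ x y : G, r • commAdd x y = 0)
    (m : Additive (commutator G)) : r • m = 0 := by
  suffices H : ∀ m (hm : m ∈ commutator G),
      r • (Additive.ofMul ⟨m, hm⟩ : Additive (commutator G)) = 0 from H m.toMul m.toMul.2
  intro m hm
  have hm' := hm
  rw [commutator_eq_closure] at hm'
  induction hm' using Subgroup.closure_induction with
  | mem g hg =>
    obtain ⟨x, y, rfl⟩ := hg
    convert h x⁻¹ y⁻¹ using 2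
    apply additive_ext
    change ⁅x, y⁆ = comm x⁻¹ y⁻¹
    simp [comm, commutatorElement_def]
  | one => exact smul_zero r
  | mul a b ha hb iha ihb =>
    rw [← commutator_eq_closure] at ha hb
    have e : (Additive.ofMul ⟨a * b, hm⟩ : Additive (commutator G)) =
      Additive.ofMul ⟨a, ha⟩ + Additive.ofMul ⟨b, hb⟩ := rfl
    rw [e, smul_add, iha, ihb, add_zero]
  | inv a ha iha =>
    rw [← commutator_eq_closure] at ha
    have e : (Additive.ofMul ⟨a⁻¹, hm⟩ : Additive (commutator G)) =
      -Additive.ofMul ⟨a, ha⟩ := rfl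
    rw [e, smul_neg, iha, neg_zero]

end

/-! ### From vanishing commutators to the upper bounds on the class -/

theorem classAtMost_of_upperCentralSeries_eq_top {G : Type*} [Group G] {n : ℕ}
    (h : Subgroup.upperCentralSeries G n = ⊤) : ClassAtMost n G :=
  have : Group.IsNilpotent G := ⟨n, h⟩
  ⟨this, Subgroup.upperCentralSeries_eq_top_iff_nilpotencyClass_le.1 h⟩

theorem commutatorElement_eq_comm {G : Type*} [Group G] (x y : G) :
    ⁅x, y⁆ = comm x⁻¹ y⁻¹ := by
  simp [comm, commutatorElement_def]

theorem mem_upperCentralSeries_succ_iff_comm {G : Type*} [Group G] {n : ℕ} {x : G} :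
    x ∈ Subgroup.upperCentralSeries G (n + 1) ↔
      ∀ y, comm x y ∈ Subgroup.upperCentralSeries G n := by
  have key : ∀ x : G, x ∈ Subgroup.upperCentralSeries G (n + 1) →
      ∀ y, comm x⁻¹ y ∈ Subgroup.upperCentralSeries G n := fun x hx y => by
    simpa [commutatorElement_eq_comm] using Subgroup.mem_upperCentralSeries_succ_iff.1 hx y⁻¹
  refine ⟨fun hx y => ?_, fun hx => ?_⟩
  · simpa using key x⁻¹ (inv_mem hx) y
  · rw [← inv_mem_iff, Subgroup.mem_upperCentralSeries_succ_iff]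
    intro y
    simpa [commutatorElement_eq_comm] using hx y⁻¹

theorem upperCentralSeries_succ_eq_top {G : Type*} [Group G] {n : ℕ}
    (h : commutator G ≤ Subgroup.upperCentralSeries G n) :
    Subgroup.upperCentralSeries G (n + 1) = ⊤ :=
  eq_top_iff.2 fun x _ => mem_upperCentralSeries_succ_iff_comm.2 fun y =>
    h (comm_mem_commutator x y)

theorem isMulCommutative_commutator {G : Type*} [Group G] (h : IsMetabelian G) :
    IsMulCommutative (commutator G) := by
  rw [IsMetabelian, derivedSeries_succ, derivedSeries_one,
    Subgroup.commutator_eq_bot_iff_le_centralizer, Subgroup.le_centralizer_iff_isMulCommutative]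
    at h
  exact h

section
open scoped IsMulCommutative

theorem classAtMost_three {p : ℕ} [Fact p.Prime] {G : Type*} [Group G] [Finite G]
    (hp : IsPGroup p G) (hmet : IsMetabelian G) (hE : IsEngel 3 G) (hodd : Odd p) :
    ClassAtMost 3 G := by
  have := isMulCommutative_commutator hmet
  have h0 := (isEngelAction hE).weightFour_eq_bot hodd (isNilpotent_natCast_conjRing hp)
    (exists_conjHom_pow_eq_one hp)
  refine classAtMost_of_upperCentralSeries_eq_top (upperCentralSeries_succ_eq_top fun m hm => ?_)
  simp only [mem_upperCentralSeries_succ_iff_comm, Subgroup.upperCentralSeries_zero,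
    Subgroup.mem_bot]
  intro x y
  -- The factors stand in reverse order because the rightmost one acts first.
  have h1 := smul_eq_zero_of_forall_commAdd (r := (conjHom G y - 1) * (conjHom G x - 1))
    (fun a b => by
      have := IsEngelAction.mem_weightFour (t := conjHom G) (d := commAdd) y x a b
      rwa [h0, Submodule.mem_bot] at this) (Additive.ofMul ⟨m, hm⟩)
  rw [mul_smul] at h1
  have h2 := congrArg (fun m : Additive (commutator G) => (m.toMul : G)) h1
  simpa only [toMul_conjHom_sub_one_smul, toMul_ofMul, toMul_zero, Subgroup.coe_one] using h2

theorem classAtMost_four {G : Type*} [Group G] [Finite G]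
    (hp : IsPGroup 2 G) (hmet : IsMetabelian G) (hE : IsEngel 3 G)
    (hpow : commutator G ≤ powerSubgroup G 4) : ClassAtMost 4 G := by
  have := isMulCommutative_commutator hmet
  have : Fact (Nat.Prime 2) := ⟨Nat.prime_two⟩
  have h0 := (isEngelAction hE).weightFive_eq_bot (isNilpotent_natCast_conjRing hp)
    (exists_conjHom_pow_eq_one hp) (fun x y => hpow (comm_mem_commutator x y))
  refine classAtMost_of_upperCentralSeries_eq_top (upperCentralSeries_succ_eq_top fun m hm => ?_)
  simp only [mem_upperCentralSeries_succ_iff_comm, Subgroup.upperCentralSeries_zero,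
    Subgroup.mem_bot]
  intro x y z
  have h1 := smul_eq_zero_of_forall_commAdd
    (r := (conjHom G z - 1) * (conjHom G y - 1) * (conjHom G x - 1))
    (fun a b => by
      have := IsEngelAction.mem_weightFive (t := conjHom G) (d := commAdd) z y x a b
      rwa [h0, Submodule.mem_bot] at this) (Additive.ofMul ⟨m, hm⟩)
  rw [mul_smul, mul_smul] at h1
  have h2 := congrArg (fun m : Additive (commutator G) => (m.toMul : G)) h1
  simpa only [toMul_conjHom_sub_one_smul, toMul_ofMul, toMul_zero, Subgroup.coe_one] using h2

end

theorem upper_bounds (p r : ℕ) (G : Type*) [Group G] [Finite G] (hp : p.Prime)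
    (h : IsPowerfulMetabelianThreeEngel p r G) :
    (Odd p → ClassAtMost 3 G) ∧ (p = 2 → ClassAtMost 4 G) := by
  have : Fact p.Prime := ⟨hp⟩
  refine ⟨classAtMost_three h.powerful.isPGroup h.metabelian h.engel, ?_⟩
  rintro rfl
  exact classAtMost_four h.powerful.isPGroup h.metabelian h.engel
    (by simpa using h.powerful.commutator_le)

/-! ### Class, rank and direct products with elementary abelian groups -/

section basic
variable {G H : Type*} [Group G] [Group H]

theorem map_comm (f : G →* H) (x y : G) : f (comm x y) = comm (f x) (f y) := by
  simp [comm]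

theorem commutator_le_of_comm_mem {K : Subgroup G} (h : ∀ x y, comm x y ∈ K) :
    commutator G ≤ K :=
  Subgroup.commutator_le.2 fun x _ y _ => commutatorElement_eq_comm x y ▸ h _ _

theorem isMetabelian_of_comm_mem {K : Subgroup G} (h : ∀ x y, comm x y ∈ K)
    (hK : ∀ x ∈ K, ∀ y ∈ K, x * y = y * x) : IsMetabelian G := by
  rw [IsMetabelian, derivedSeries_succ, derivedSeries_one, eq_bot_iff, Subgroup.commutator_le]
  intro x hx y hy
  have hle := commutator_le_of_comm_mem h
  rw [Subgroup.mem_bot, commutatorElement_eq_one_iff_mul_comm]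
  exact hK x (hle hx) y (hle hy)

theorem isEngel_three_iff : IsEngel 3 G ↔ ∀ x y : G, comm (comm (comm y x) x) x = 1 := Iff.rfl

theorem map_powerSubgroup_le (f : G →* H) (k : ℕ) :
    (powerSubgroup G k).map f ≤ powerSubgroup H k := by
  rw [powerSubgroup, MonoidHom.map_closure, Subgroup.closure_le]
  rintro _ ⟨_, ⟨g, rfl⟩, rfl⟩
  exact Subgroup.subset_closure ⟨f g, (map_pow f g k).symm⟩

theorem pow_mem_powerSubgroup (g : G) (k : ℕ) : g ^ k ∈ powerSubgroup G k :=
  Subgroup.subset_closure ⟨g, rfl⟩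

theorem classEq_succ {n : ℕ} (h : ClassAtMost (n + 1) G)
    (hn : Subgroup.upperCentralSeries G n ≠ ⊤) : ClassEq (n + 1) G := by
  obtain ⟨h1, h2⟩ := h
  refine ⟨h1, le_antisymm h2 (Nat.lt_of_not_le fun h3 => hn ?_)⟩
  exact Subgroup.upperCentralSeries_eq_top_iff_nilpotencyClass_le.2 h3

end basic

/-- `G` is generated by a family indexed by `ι` whose images in some elementary abelian quotient of
`G` form a basis. -/
def HasBasisMod (p : ℕ) (ι : Type) [Fintype ι] [DecidableEq ι] (G : Type*) [Group G] : Prop :=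
  ∃ (gen : ι → G) (f : G →* Multiplicative (ι → ZMod p)),
    Subgroup.closure (Set.range gen) = ⊤ ∧ ∀ i, f (gen i) = Multiplicative.ofAdd (Pi.single i 1)

section rank
variable {p : ℕ} {ι : Type} [Fintype ι] [DecidableEq ι] {G : Type*} [Group G]

/-- A generating set of `G` maps onto a spanning set of the vector space `ι → ZMod p`, so it has at
least `card ι` elements. -/
theorem HasBasisMod.card_le_rank [Fact p.Prime] [Group.FG G] (h : HasBasisMod p ι G) :
    Fintype.card ι ≤ Group.rank G := by
  obtain ⟨gen, f, -, hf⟩ := h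
  obtain ⟨S, hS, hS'⟩ := Group.rank_spec G
  classical
  let T : Finset (ι → ZMod p) := S.image fun g => (f g).toAdd
  have key : ∀ g, (f g).toAdd ∈ Submodule.span (ZMod p) (T : Set (ι → ZMod p)) := fun g => by
    have hg : g ∈ Subgroup.closure (S : Set G) := hS' ▸ Subgroup.mem_top g
    induction hg using Subgroup.closure_induction with
    | mem x hx => exact Submodule.subset_span (by simpa [T] using ⟨x, hx, rfl⟩)
    | one => simp
    | mul x y _ _ hx hy => simpa using add_mem hx hy
    | inv x _ hx => simpa using hx
  have htop : Submodule.span (ZMod p) (T : Set (ι → ZMod p)) = ⊤ := by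
    rw [eq_top_iff, ← (Pi.basisFun (ZMod p) ι).span_eq, Submodule.span_le]
    rintro _ ⟨i, rfl⟩
    have := key (gen i)
    rw [hf] at this
    simpa using this
  have h1 := finrank_span_finset_le_card (R := ZMod p) T
  rw [Set.finrank, htop, finrank_top, Module.finrank_fintype_fun_eq_card] at h1
  exact h1.trans (Finset.card_image_le.trans hS.le)

theorem HasBasisMod.rank_le [Group.FG G] (h : HasBasisMod p ι G) :
    Group.rank G ≤ Fintype.card ι := by
  obtain ⟨gen, f, hgen, -⟩ := h
  classical
  refine (Group.rank_le (S := Finset.univ.image gen) (by simpa using hgen)).trans ?_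
  exact Finset.card_image_le

theorem HasBasisMod.rank_eq [Fact p.Prime] [Group.FG G] (h : HasBasisMod p ι G) :
    Group.rank G = Fintype.card ι :=
  le_antisymm h.rank_le h.card_le_rank

theorem HasBasisMod.prod {κ : Type} [Fintype κ] [DecidableEq κ] [NeZero p]
    (h : HasBasisMod p ι G) :
    HasBasisMod p (ι ⊕ κ) (G × Multiplicative (κ → ZMod p)) := by
  obtain ⟨gen, f, hgen, hf⟩ := h
  refine ⟨Sum.elim (fun i => (gen i, 1)) fun k => (1, Multiplicative.ofAdd (Pi.single k 1)),
    { toFun := fun x => Multiplicative.ofAdd (Sum.elim (f x.1).toAdd x.2.toAdd)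
      map_one' := ?_
      map_mul' := ?_ }, ?_, ?_⟩
  · apply Multiplicative.toAdd.injective
    funext i
    cases i <;> simp
  · intro x y
    apply Multiplicative.toAdd.injective
    funext i
    cases i <;> simp
  · set C := Subgroup.closure (Set.range (Sum.elim (fun i => (gen i, 1))
      fun k => (1, Multiplicative.ofAdd (Pi.single k 1)) : ι ⊕ κ → G × Multiplicative (κ → ZMod p)))
    have hG : ∀ g : G, (g, 1) ∈ C := fun g => by
      have : Subgroup.closure (Set.range gen) ≤ C.comap (MonoidHom.inl G _) := by
        rw [Subgroup.closure_le]
        rintro _ ⟨i, rfl⟩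
        exact Subgroup.subset_closure ⟨Sum.inl i, rfl⟩
      exact (hgen ▸ this) (Subgroup.mem_top g)
    have hV : ∀ v : κ → ZMod p, (1, Multiplicative.ofAdd v) ∈ C := fun v => by
      rw [← Finset.univ_sum_single v]
      refine Finset.sum_induction _ (fun w => ((1 : G), Multiplicative.ofAdd w) ∈ C)
        (fun a b ha hb => by simpa using mul_mem ha hb) (one_mem C) fun k _ => ?_
      have e : Pi.single k (v k) = (v k).val • (Pi.single k 1 : κ → ZMod p) := by
        rw [← Pi.single_smul]
        simp
      have hk : ((1 : G), Multiplicative.ofAdd (Pi.single k 1 : κ → ZMod p)) ∈ C :=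
        Subgroup.subset_closure ⟨Sum.inr k, rfl⟩
      have := pow_mem hk (v k).val
      rwa [Prod.pow_mk, one_pow, ← ofAdd_nsmul, ← e] at this
    refine eq_top_iff.2 fun x _ => ?_
    simpa using mul_mem (hG x.1) (hV x.2.toAdd)
  · rintro (i | k)
    · apply Multiplicative.toAdd.injective
      funext j
      cases j <;> simp [hf, Pi.single_apply]
    · apply Multiplicative.toAdd.injective
      funext j
      cases j <;> simp [Pi.single_apply]

end rank

theorem pow_eq_one_of_zmod {p : ℕ} {ι : Type*} (x : Multiplicative (ι → ZMod p)) : x ^ p = 1 :=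
  Multiplicative.toAdd.injective (by funext i; simp)

/-- The new factor is abelian of exponent `p`, so commutators are unchanged; the basis `hb`
certifies that the rank grows by exactly `k`. -/
theorem IsPowerfulMetabelianThreeEngel.prod {p r k : ℕ} [Fact p.Prime] {G : Type} [Group G]
    [Finite G] (h : IsPowerfulMetabelianThreeEngel p r G) {ι : Type} [Fintype ι] [DecidableEq ι]
    (hb : HasBasisMod p ι G) :
    IsPowerfulMetabelianThreeEngel p (r + k) (G × Multiplicative (Fin k → ZMod p)) := by
  refine ⟨⟨?_, ?_⟩, ?_, ?_, ?_⟩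
  · intro x
    obtain ⟨n, hn⟩ := h.powerful.isPGroup x.1
    refine ⟨n + 1, Prod.ext ?_ ?_⟩
    · change x.1 ^ p ^ (n + 1) = 1
      rw [pow_succ, pow_mul, hn, one_pow]
    · change x.2 ^ p ^ (n + 1) = 1
      rw [pow_succ', pow_mul]
      rw [pow_eq_one_of_zmod, one_pow]
  · refine commutator_le_of_comm_mem fun x y => ?_
    have e : comm x y = MonoidHom.inl G (Multiplicative (Fin k → ZMod p)) (comm x.1 y.1) :=
      Prod.ext rfl (by simp [comm, mul_comm])
    rw [e]
    exact map_powerSubgroup_le _ _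
      (Subgroup.mem_map_of_mem _ (h.powerful.commutator_le (comm_mem_commutator _ _)))
  · have := isMulCommutative_commutator h.metabelian
    refine isMetabelian_of_comm_mem (K := (commutator G).prod ⊤)
      (fun x y => ⟨comm_mem_commutator x.1 y.1, trivial⟩) fun x hx y hy => ?_
    exact Prod.ext (commutator_mul_comm hx.1 hy.1) (mul_comm _ _)
  · rw [isEngel_three_iff]
    intro x y
    exact Prod.ext (h.engel x.1 y.1) (by simp [comm, mul_comm])
  · rw [(hb.prod (κ := Fin k)).rank_eq, Fintype.card_sum, Fintype.card_fin, ← h.rank_eq, hb.rank_eq]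

theorem ClassEq.prod_comm {c : ℕ} {G V : Type*} [Group G] [CommGroup V] (hc : 1 ≤ c)
    (h : ClassEq c G) : ClassEq c (G × V) := by
  obtain ⟨h1, h2⟩ := h
  refine ⟨inferInstance, ?_⟩
  rw [Group.nilpotencyClass_prod, h2]
  exact max_eq_left (CommGroup.nilpotencyClass_le_one.trans hc)

/-! ### The example of class 3 for odd primes -/

/-- The semidirect product of `ZMod (p ^ 3)` with itself, `1` acting as multiplication by
`1 + p`. -/
@[ext]
structure AffineGroup (p : ℕ) where
  left : ZMod (p ^ 3)
  right : ZMod (p ^ 3)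

namespace AffineGroup
variable {p : ℕ}

variable (p) in
/-- The inverse of `2` modulo `p`, for odd `p`. -/
def half : ZMod (p ^ 3) := (((p + 1) / 2 : ℕ) : ZMod (p ^ 3))

/-- The quotient of `(1 + p) ^ k - 1` by `p` in `ZMod (p ^ 3)`, for odd `p`. -/
def slope (k : ZMod (p ^ 3)) : ZMod (p ^ 3) := k + p * half p * (k * (k - 1))

/-- The power `(1 + p) ^ k` in `ZMod (p ^ 3)`, for odd `p`. -/
def unit (k : ZMod (p ^ 3)) : ZMod (p ^ 3) := 1 + p * slope k

theorem cast_pow_three : (p : ZMod (p ^ 3)) ^ 3 = 0 := by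
  exact_mod_cast ZMod.natCast_self (p ^ 3)

theorem unit_zero : unit (0 : ZMod (p ^ 3)) = 1 := by simp [unit, slope]

theorem two_mul_half (h : Odd p) : 2 * half p = p + 1 := by
  obtain ⟨k, rfl⟩ := h
  unfold half
  rw [show (2 * k + 1 + 1) / 2 = k + 1 by omega]
  push_cast
  ring

/-- `unit k` is the binomial expansion `1 + p k + p² k(k-1)/2` cut off at `p³`. The cross term needs
`p² * 2 * half = p²`, so `half` need only invert 2 modulo `p`. -/
theorem unit_add (h : Odd p) (k l : ZMod (p ^ 3)) : unit (k + l) = unit k * unit l := by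
  have h3 := cast_pow_three (p := p)
  have h2 := two_mul_half h
  unfold unit slope
  linear_combination (p ^ 2 * k * l) * h2 + (k * l - half p * k * l * (k - 1) - half p * k * l * (l - 1)
    - p * half p ^ 2 * k * l * (k - 1) * (l - 1)) * h3

theorem unit_sub_one (k : ZMod (p ^ 3)) : unit k - 1 = p * slope k := by
  unfold unit
  ring

variable [hp : Fact (Odd p)]

instance : Group (AffineGroup p) where
  mul a b := ⟨a.left * unit b.right + b.left, a.right + b.right⟩
  one := ⟨0, 0⟩
  inv a := ⟨-a.left * unit (-a.right), -a.right⟩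
  mul_assoc a b c := by
    refine AffineGroup.ext ?_ (add_assoc _ _ _)
    change (a.left * unit b.right + b.left) * unit c.right + c.left =
      a.left * unit (b.right + c.right) + (b.left * unit c.right + c.left)
    rw [unit_add hp.out]
    ring
  one_mul a := by
    refine AffineGroup.ext ?_ (zero_add _)
    change 0 * unit a.right + a.left = a.left
    ring
  mul_one a := by
    refine AffineGroup.ext ?_ (add_zero _)
    change a.left * unit 0 + 0 = a.left
    rw [unit_zero]
    ring
  inv_mul_cancel a := by
    refine AffineGroup.ext ?_ (neg_add_cancel _)
    change -a.left * unit (-a.right) * unit a.right + a.left = 0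
    rw [mul_assoc, ← unit_add hp.out, neg_add_cancel, unit_zero]
    ring

theorem mul_left (a b : AffineGroup p) : (a * b).left = a.left * unit b.right + b.left := rfl
theorem mul_right (a b : AffineGroup p) : (a * b).right = a.right + b.right := rfl

theorem comm_eq (a b : AffineGroup p) :
    comm a b = ⟨a.left * (unit b.right - 1) - b.left * (unit a.right - 1), 0⟩ := by
  have e : comm a b = (b * a)⁻¹ * (a * b) := by simp [comm, mul_assoc]
  rw [e, inv_mul_eq_iff_eq_mul]
  refine AffineGroup.ext ?_ ?_
  · simp only [mul_left, unit_zero]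
    ring
  · simp only [mul_right]
    ring

theorem mk_pow (x : ZMod (p ^ 3)) (n : ℕ) : (⟨x, 0⟩ : AffineGroup p) ^ n = ⟨n * x, 0⟩ := by
  induction n with
  | zero => exact AffineGroup.ext (by simp; rfl) rfl
  | succ n ih =>
    rw [pow_succ, ih]
    refine AffineGroup.ext ?_ ?_
    · rw [mul_left, unit_zero]
      push_cast
      ring
    · simp [mul_right]

theorem mk_pow_right (n : ℕ) : (⟨0, 1⟩ : AffineGroup p) ^ n = ⟨0, n⟩ := by
  induction n with
  | zero => exact AffineGroup.ext rfl (by simp; rfl)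
  | succ n ih =>
    rw [pow_succ, ih]
    exact AffineGroup.ext (by simp [mul_left]) (by simp [mul_right])

variable (p) in
/-- The underlying type is a product. -/
def equivProd : AffineGroup p ≃ ZMod (p ^ 3) × ZMod (p ^ 3) where
  toFun a := (a.left, a.right)
  invFun a := ⟨a.1, a.2⟩
  left_inv _ := rfl
  right_inv _ := rfl

variable [Fact p.Prime]

instance : Finite (AffineGroup p) :=
  have : NeZero (p ^ 3) := ⟨pow_ne_zero _ (Fact.out : p.Prime).ne_zero⟩
  Finite.of_equiv _ (equivProd p).symm

theorem hasBasisMod : HasBasisMod p (Fin 2) (AffineGroup p) := by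
  have hdvd : p ∣ p ^ 3 := dvd_pow_self p (by norm_num)
  have : NeZero (p ^ 3) := ⟨pow_ne_zero _ (Fact.out : p.Prime).ne_zero⟩
  have hunit : ∀ k, ZMod.castHom hdvd (ZMod p) (unit k) = 1 := fun k => by simp [unit]
  refine ⟨![⟨1, 0⟩, ⟨0, 1⟩], 
    { toFun := fun a => Multiplicative.ofAdd
        (![ZMod.castHom hdvd (ZMod p) a.left, ZMod.castHom hdvd (ZMod p) a.right])
      map_one' := ?_
      map_mul' := ?_ }, ?_, ?_⟩
  · apply Multiplicative.toAdd.injective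
    change ![ZMod.castHom hdvd (ZMod p) 0, ZMod.castHom hdvd (ZMod p) 0] = 0
    simp
  · intro a b
    apply Multiplicative.toAdd.injective
    simp only [mul_left, mul_right, map_add, map_mul, hunit]
    simp
  · refine eq_top_iff.2 fun a _ => ?_
    have e : a = ⟨0, 1⟩ ^ a.right.val * ⟨1, 0⟩ ^ a.left.val := by
      rw [mk_pow, mk_pow_right]
      exact AffineGroup.ext (by simp [mul_left]) (by simp [mul_right])
    rw [e]
    refine mul_mem (pow_mem ?_ _) (pow_mem ?_ _)
    · exact Subgroup.subset_closure ⟨1, rfl⟩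
    · exact Subgroup.subset_closure ⟨0, rfl⟩
  · intro i
    apply Multiplicative.toAdd.injective
    fin_cases i
    · funext j
      fin_cases j <;> simp
    · funext j
      fin_cases j <;> simp

theorem isPowerfulMetabelianThreeEngel :
    IsPowerfulMetabelianThreeEngel p 2 (AffineGroup p) := by
  have hp2 : p ≠ 2 := by
    rintro rfl
    exact absurd hp.out (by decide)
  refine ⟨⟨?_, ?_⟩, ?_, ?_, ?_⟩
  · refine IsPGroup.of_card (n := 6) ?_
    rw [Nat.card_congr (equivProd p), Nat.card_prod, Nat.card_zmod]
    ring
  · rw [if_neg hp2]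
    refine commutator_le_of_comm_mem fun a b => ?_
    rw [comm_eq, unit_sub_one, unit_sub_one]
    convert pow_mem_powerSubgroup 
      (⟨a.left * slope b.right - b.left * slope a.right, 0⟩ : AffineGroup p) p using 1
    rw [mk_pow]
    congr 1
    ring
  · let K : Subgroup (AffineGroup p) :=
      { carrier := {a | a.right = 0}
        one_mem' := rfl
        mul_mem' := fun {a b} ha hb => by
          change a.right + b.right = 0
          rw [show a.right = 0 from ha, show b.right = 0 from hb, add_zero]
        inv_mem' := fun {a} ha => by
          change -a.right = 0
          rw [show a.right = 0 from ha, neg_zero] }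
    refine isMetabelian_of_comm_mem (K := K) (fun a b => ?_) fun a ha b hb => ?_
    · rw [comm_eq]
      exact rfl
    · have ha' : a.right = 0 := ha
      have hb' : b.right = 0 := hb
      refine AffineGroup.ext ?_ (add_comm _ _)
      rw [mul_left, mul_left, ha', hb', unit_zero]
      ring
  · rw [isEngel_three_iff]
    intro a b
    have h3 := cast_pow_three (p := p)
    simp only [comm_eq, unit_zero, unit_sub_one, sub_self, mul_zero, sub_zero]
    refine AffineGroup.ext ?_ rfl
    change _ = (0 : ZMod (p ^ 3))
    -- Commutators lie in the left factor, and each of the three commutations with `a` contributes a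
    -- factor `p`.
    linear_combination ((b.left * slope a.right - a.left * slope b.right) * slope a.right ^ 2) * h3
  · rw [hasBasisMod.rank_eq, Fintype.card_fin]

theorem classEq_three : ClassEq 3 (AffineGroup p) := by
  refine classEq_succ ((upper_bounds p 2 _ Fact.out isPowerfulMetabelianThreeEngel).1 hp.out) ?_
  intro h
  have h1 : (⟨1, 0⟩ : AffineGroup p) ∈ Subgroup.upperCentralSeries (AffineGroup p) 2 :=
    h ▸ Subgroup.mem_top _
  -- Since `slope 1 = 1`, commuting `⟨1, 0⟩` twice with `⟨0, 1⟩` gives `p ^ 2`, nonzero modulo `p ^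
  -- 3`.
  have h2 := mem_upperCentralSeries_succ_iff_comm.1
    (mem_upperCentralSeries_succ_iff_comm.1 h1 ⟨0, 1⟩) ⟨0, 1⟩
  rw [Subgroup.upperCentralSeries_zero, Subgroup.mem_bot, comm_eq, comm_eq] at h2
  have h3 := congrArg AffineGroup.left h2
  simp only [unit_sub_one, slope] at h3
  have h4 : ((p ^ 2 : ℕ) : ZMod (p ^ 3)) = 0 := by
    refine Eq.trans ?_ h3
    push_cast
    ring
  rw [ZMod.natCast_eq_zero_iff] at h4
  exact absurd (Nat.pow_dvd_pow_iff_le_right (Fact.out : p.Prime).one_lt |>.1 h4) (by norm_num)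

end AffineGroup

theorem exists_class_three (p r : ℕ) (hp : p.Prime) (hodd : Odd p) (hr : 3 ≤ r) :
    ∃ (G : Type) (_ : Group G) (_ : Finite G),
      IsPowerfulMetabelianThreeEngel p r G ∧ ClassEq 3 G := by
  have : Fact p.Prime := ⟨hp⟩
  have : Fact (Odd p) := ⟨hodd⟩
  obtain ⟨k, rfl⟩ := Nat.exists_eq_add_of_le (show 2 ≤ r by omega)
  exact ⟨AffineGroup p × Multiplicative (Fin k → ZMod p), inferInstance, inferInstance,
    AffineGroup.isPowerfulMetabelianThreeEngel.prod AffineGroup.hasBasisMod,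
    AffineGroup.classEq_three.prod_comm (by norm_num)⟩

/-! ### A matrix representation in which `a ^ 2 ^ 11` survives -/

namespace ExampleGroup

/-- The ring of the matrix representation in which `a ^ 2 ^ 11` acts nontrivially. -/
abbrev Mat : Type := Matrix (Fin 5) (Fin 5) (ZMod 4096)

/-- The image of `a`, acting on row vectors. -/
def matA : Matˣ where
  val := !![1, 1, 0, 0, 2048; 0, 1, 0, 0, 2048; 0, 0, 1, 0, 0; 0, 0, 0, 1, 0; 0, 0, 0, 0, 1]
  inv := !![1, -1, 0, 0, 0; 0, 1, 0, 0, 2048; 0, 0, 1, 0, 0; 0, 0, 0, 1, 0; 0, 0, 0, 0, 1]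
  val_inv := by decide +kernel
  inv_val := by decide +kernel

/-- Matrices of the shape occurring for powers of `b`. -/
def formB (x y z w : ZMod 4096) : Mat :=
  !![1, 0, x, y, 0; 0, z, 0, 0, 0; 0, 0, 1, w, 0; 0, 0, 0, 1, 0; 0, 0, 0, 0, 1]

/-- The image of `b`. -/
def matB : Matˣ where
  val := formB 2 0 (-31) 64
  inv := formB (-2) 128 1057 (-64)
  val_inv := by decide +kernel
  inv_val := by decide +kernel

/-- Matrices of the shape occurring for powers of `c`. -/
def formC (i₁ i₂ j₁ j₂ k₁ k₂ l₁ l₂ : ZMod 4096) : Mat :=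
  !![1, 0, 0, 0, 0; 0, i₁, i₂, 0, 0; 0, j₁, j₂, 0, 0; 0, k₁, k₂, 1, 0; 0, l₁, l₂, 0, 1]

/-- The image of `c`. -/
def matC : Matˣ where
  val := formC 17 384 2 129 (-1) 0 1 0
  inv := formC 1009 1664 2334 641 1009 1664 3087 2432
  val_inv := by decide +kernel
  inv_val := by decide +kernel

/-- The relators act trivially on the row space of this matrix. -/
def diag : Mat := Matrix.diagonal ![1, 1, 2, 128, 2048]

/-- The representation of the free group. -/
def rep : FreeGroup (Fin 3) →* Matˣ := FreeGroup.lift ![matA, matB, matC]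

theorem rep_genA : rep genA = matA := by simp [rep, genA]
theorem rep_genB : rep genB = matB := by simp [rep, genB]
theorem rep_genC : rep genC = matC := by simp [rep, genC]

/-- The row space of `diag` is a sum of cyclic groups of orders `2^12, 2^12, 2^11, 2^5, 2`, all
embedded in `ZMod 4096`. The matrix `s` certifies that it is invariant: its entries are those of
`rep w`, rescaled by the diagonal. Invariance is what makes `trivialWords` normal. -/
theorem exists_mul_diag (w : FreeGroup (Fin 3)) : ∃ s : Mat, diag * rep w = s * diag := by
  induction w using FreeGroup.induction_on with
  | C1 => exact ⟨1, by simp⟩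
  | of i =>
    fin_cases i
    · exact ⟨!![1, 1, 0, 0, 1; 0, 1, 0, 0, 1; 0, 0, 1, 0, 0; 0, 0, 0, 1, 0; 0, 0, 0, 0, 1], by
        change diag * (rep genA : Mat) = _
        rw [rep_genA]; decide +kernel⟩
    · exact ⟨formB 1 0 (-31) 1, by
        change diag * (rep genB : Mat) = _
        rw [rep_genB]; decide +kernel⟩
    · exact ⟨formC 17 192 4 129 (-128) 0 2048 0, by
        change diag * (rep genC : Mat) = _
        rw [rep_genC]; decide +kernel⟩
  | inv_of i _ =>
    fin_cases i
    · exact ⟨!![1, -1, 0, 0, 0; 0, 1, 0, 0, 1; 0, 0, 1, 0, 0; 0, 0, 0, 1, 0; 0, 0, 0, 0, 1], by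
        change diag * (rep genA⁻¹ : Mat) = _
        rw [map_inv, rep_genA]; decide +kernel⟩
    · exact ⟨formB (-1) 1 1057 (-1), by
        change diag * (rep genB⁻¹ : Mat) = _
        rw [map_inv, rep_genB]; decide +kernel⟩
    · exact ⟨formC 1009 832 4668 641 (1009 * 128) (832 * 128) (3087 * 2048) (1216 * 2048), by
        change diag * (rep genC⁻¹ : Mat) = _
        rw [map_inv, rep_genC]; decide +kernel⟩
  | mul x y hx hy =>
    obtain ⟨s, hs⟩ := hx
    obtain ⟨s', hs'⟩ := hy
    exact ⟨s * s', by rw [map_mul, Units.val_mul, ← mul_assoc, hs, mul_assoc, hs', mul_assoc]⟩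

/-- The words acting trivially on the row space of `diag`. -/
def trivialWords : Subgroup (FreeGroup (Fin 3)) where
  carrier := {w | diag * (rep w : Mat) = diag}
  one_mem' := by simp
  mul_mem' := fun {x y} hx hy => by
    change diag * (rep (x * y) : Mat) = diag
    rw [map_mul, Units.val_mul, ← mul_assoc, show diag * (rep x : Mat) = diag from hx]
    exact hy
  inv_mem' := fun {x} hx => by
    change diag * (rep x⁻¹ : Mat) = diag
    rw [map_inv, Units.mul_inv_eq_iff_eq_mul]
    exact (show diag * (rep x : Mat) = diag from hx).symm

theorem mem_trivialWords {w : FreeGroup (Fin 3)} :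
    w ∈ trivialWords ↔ diag * (rep w : Mat) = diag := Iff.rfl

instance : trivialWords.Normal where
  conj_mem n hn g := by
    obtain ⟨s, hs⟩ := exists_mul_diag g
    rw [mem_trivialWords] at hn ⊢
    rw [map_mul, map_mul, Units.val_mul, Units.val_mul, ← mul_assoc, ← mul_assoc, hs, mul_assoc s,
      hn, ← hs, mul_assoc, ← Units.val_mul, ← map_mul, mul_inv_cancel, map_one, Units.val_one,
      mul_one]

/-- The relation `[x,y] = z` is tested as `xy = yxz`, free of inverses; the two relators are
conjugate by `y * x`. -/
theorem comm_mul_inv_mem {x y z : FreeGroup (Fin 3)}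
    (h : diag * (rep x * rep y : Mat) = diag * (rep y * rep x * rep z : Mat)) :
    comm x y * z⁻¹ ∈ trivialWords := by
  have h1 : x * y * (y * x * z)⁻¹ ∈ trivialWords := by
    rw [mem_trivialWords, map_mul, map_inv, Units.val_mul, ← mul_assoc,
      Units.mul_inv_eq_iff_eq_mul]
    simpa only [map_mul, Units.val_mul] using h
  have h2 := (inferInstance : trivialWords.Normal).conj_mem _ h1 (y * x)⁻¹
  convert h2 using 1
  simp [comm, mul_assoc]

theorem pow_two_mul_eq {M N N' : Mat} {n : ℕ} (h : M ^ n = N) (h' : N * N = N') :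
    M ^ (n * 2) = N' := by
  rw [pow_mul, h, pow_two, h']

/-- The matrix of `a ^ x`, for `x` divisible by `4`. -/
def transA (x : ZMod 4096) : Mat :=
  !![1, x, 0, 0, 0; 0, 1, 0, 0, 0; 0, 0, 1, 0, 0; 0, 0, 0, 1, 0; 0, 0, 0, 0, 1]

/-- The matrix of `b ^ (x / 2)`, for `x` divisible by `2 ^ 8`. -/
def transB (x : ZMod 4096) : Mat :=
  !![1, 0, x, 0, 0; 0, 1, 0, 0, 0; 0, 0, 1, 0, 0; 0, 0, 0, 1, 0; 0, 0, 0, 0, 1]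

theorem transA_mul (x y : ZMod 4096) : transA x * transA y = transA (x + y) := by
  ext i j
  fin_cases i <;> fin_cases j <;> simp [transA, Matrix.mul_apply, Fin.sum_univ_five, add_comm]

theorem transB_mul (x y : ZMod 4096) : transB x * transB y = transB (x + y) := by
  ext i j
  fin_cases i <;> fin_cases j <;> simp [transB, Matrix.mul_apply, Fin.sum_univ_five, add_comm]

theorem transA_pow (x : ZMod 4096) (n : ℕ) : transA x ^ n = transA (n * x) := by
  induction n with
  | zero => ext i j; fin_cases i <;> fin_cases j <;> simp [transA]
  | succ n ih => rw [pow_succ, ih, transA_mul]; congr 1; push_cast; ring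

theorem transB_pow (x : ZMod 4096) (n : ℕ) : transB x ^ n = transB (n * x) := by
  induction n with
  | zero => ext i j; fin_cases i <;> fin_cases j <;> simp [transB]
  | succ n ih => rw [pow_succ, ih, transB_mul]; congr 1; push_cast; ring

theorem rep_genA_pow (n : ℕ) {m : ℕ} (hm : m = 4 * n) :
    (rep (genA ^ m) : Mat) = transA (n * 4) := by
  subst hm
  have h : (matA : Mat) ^ 4 = transA 4 := by decide +kernel
  rw [map_pow, rep_genA, Units.val_pow_eq_pow_val, pow_mul, h, transA_pow]

theorem matB_pow : (matB : Mat) ^ 64 = formB 128 0 2049 0 := by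
  have h1 := pow_two_mul_eq (pow_one (matB : Mat))
    (show _ = formB 4 128 961 128 by decide +kernel)
  have h2 := pow_two_mul_eq h1 (show _ = formB 8 768 1921 256 by decide +kernel)
  have h3 := pow_two_mul_eq h2 (show _ = formB 16 3584 3841 512 by decide +kernel)
  have h4 := pow_two_mul_eq h3 (show _ = formB 32 3072 3585 1024 by decide +kernel)
  have h5 := pow_two_mul_eq h4 (show _ = formB 64 2048 3073 2048 by decide +kernel)
  rw [show 64 = 1 * 2 * 2 * 2 * 2 * 2 * 2 by norm_num]
  exact pow_two_mul_eq h5 (by decide +kernel)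

theorem rep_genB_pow (n : ℕ) {m : ℕ} (hm : m = 128 * n) :
    (rep (genB ^ m) : Mat) = transB (n * 256) := by
  subst hm
  have h : (matB : Mat) ^ (64 * 2) = transB 256 := pow_two_mul_eq matB_pow (by decide +kernel)
  rw [map_pow, rep_genB, Units.val_pow_eq_pow_val, pow_mul, h, transB_pow]

/-- Repeated squaring. The result is not the identity matrix, but its off-diagonal entries vanish
once multiplied by the diagonal entries 2, 128 and 2048 of `diag`. -/
theorem matC_pow : (matC : Mat) ^ 1024 = formC 1 0 2048 1 3072 0 1024 0 := by
  have h1 := pow_two_mul_eq (pow_one (matC : Mat))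
    (show _ = formC 1057 2816 292 1025 4078 3712 18 384 by decide +kernel)
  have h2 := pow_two_mul_eq h1
    (show _ = formC 2113 1536 1736 1025 3996 1792 100 2304 by decide +kernel)
  have h3 := pow_two_mul_eq h2
    (show _ = formC 129 3072 3984 2049 3640 1536 456 2560 by decide +kernel)
  have h4 := pow_two_mul_eq h3
    (show _ = formC 257 2048 1824 1 2160 3072 1936 1024 by decide +kernel)
  have h5 := pow_two_mul_eq h4 (show _ = formC 513 0 3648 1 224 2048 3872 2048 by decide +kernel)
  have h6 := pow_two_mul_eq h5 (show _ = formC 1025 0 3200 1 448 0 3648 0 by decide +kernel)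
  have h7 := pow_two_mul_eq h6 (show _ = formC 2049 0 2304 1 896 0 3200 0 by decide +kernel)
  have h8 := pow_two_mul_eq h7 (show _ = formC 1 0 512 1 1792 0 2304 0 by decide +kernel)
  have h9 := pow_two_mul_eq h8 (show _ = formC 1 0 1024 1 3584 0 512 0 by decide +kernel)
  rw [show 1024 = 1 * 2 * 2 * 2 * 2 * 2 * 2 * 2 * 2 * 2 * 2 by norm_num]
  exact pow_two_mul_eq h9 (by decide +kernel)

theorem exampleRels_subset : exampleRels ⊆ trivialWords := by
  have a4 : (rep (genA ^ 2 ^ 2) : Mat) = transA 4 := by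
    rw [rep_genA_pow 1 (by norm_num), Nat.cast_one, one_mul]
  have b64 : (rep (genB ^ 2 ^ 6) : Mat) = formB 128 0 2049 0 := by
    rw [map_pow, rep_genB, Units.val_pow_eq_pow_val, show 2 ^ 6 = 64 by norm_num, matB_pow]
  have inv : ∀ (n : ℕ) {m : ℕ}, m = 4 * n → (rep (genA ^ m)⁻¹ : Mat) = transA (-(n * 4)) := by
    intro n m hm
    rw [map_inv]
    refine Units.inv_eq_of_mul_eq_one_right ?_
    rw [rep_genA_pow n hm, transA_mul, add_neg_cancel]
    decide +kernel
  simp only [exampleRels, Set.insert_subset_iff, Set.singleton_subset_iff, SetLike.mem_coe]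
  refine ⟨?_, ?_, ?_, ?_, ?_, ?_, ?_, ?_, ?_, ?_, ?_⟩
  · apply comm_mul_inv_mem
    rw [inv 8 (m := 2 ^ 5) rfl, rep_genA, rep_genB]
    decide +kernel
  · apply comm_mul_inv_mem
    -- The matrix of `b ^ 64` still scales the second coordinate by 2049; only powers of `b ^ 128`
    -- are pure translations.
    rw [show 3 * 2 ^ 6 = 2 ^ 6 + 128 * 1 by norm_num, pow_add, map_mul, map_mul, Units.val_mul,
      Units.val_mul, b64, rep_genB_pow 1 rfl, rep_genA_pow 4 (by norm_num), rep_genA, rep_genC]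
    decide +kernel
  · apply comm_mul_inv_mem
    rw [map_mul, Units.val_mul, rep_genB_pow 1 (by norm_num), rep_genA_pow 1 (by norm_num),
      rep_genB, rep_genC]
    decide +kernel
  · rw [← mul_one (comm _ _), ← inv_one]
    apply comm_mul_inv_mem
    rw [a4, b64, map_one]
    decide +kernel
  · apply comm_mul_inv_mem
    rw [inv 32 (m := 2 ^ 7) rfl, a4, rep_genB]
    decide +kernel
  · apply comm_mul_inv_mem
    rw [map_mul, map_mul, Units.val_mul, Units.val_mul, inv 1 (m := 2 ^ 2) rfl, a4,
      rep_genB_pow 6 (by norm_num), rep_genA_pow 17 (by norm_num), rep_genC]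
    decide +kernel
  · apply comm_mul_inv_mem
    rw [b64, rep_genA_pow 512 (by norm_num), rep_genA]
    decide +kernel
  · apply comm_mul_inv_mem
    rw [b64, rep_genA_pow 64 (by norm_num), rep_genC]
    decide +kernel
  · rw [mem_trivialWords, rep_genA_pow 1024 (by norm_num)]
    decide +kernel
  · rw [mem_trivialWords, rep_genB_pow 16 (by norm_num)]
    decide +kernel
  · rw [mem_trivialWords, map_pow, rep_genC, Units.val_pow_eq_pow_val,
      show 2 ^ 10 = 1024 by norm_num, matC_pow]
    decide +kernel

/-- `a ^ 2048` acts as `transA 2048`, which moves the first row of `diag`, whereas the normal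
closure of the relators acts trivially. -/
theorem of_pow_ne_one : (PresentedGroup.of 0 : ExampleGroup) ^ 2048 ≠ 1 := by
  intro h
  have h1 : PresentedGroup.mk exampleRels (genA ^ 2048) = 1 := h
  have h2 := Subgroup.normalClosure_le_normal exampleRels_subset
    ((QuotientGroup.eq_one_iff (genA ^ 2048)).1 h1)
  rw [mem_trivialWords, rep_genA_pow 512 (by norm_num)] at h2
  revert h2
  decide +kernel

end ExampleGroup

/-! ### The action on the subgroup generated by `a ^ 4` and `b ^ 64` -/

/-- A consequence of the relations of the explicit group, for the subgroup generated by
`u = a ^ 4` and `v = b ^ 64`: the way in which the generators act on it. -/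
structure ActsBy {G : Type*} [Group G] (u v g : G) (i j k : ℤ) : Prop where
  left : g⁻¹ * u * g = u ^ (1 + 16 * k - 32 * j + 512 * j * k) * v ^ (12 * k)
  right : g⁻¹ * v * g = u ^ (512 * i + 64 * k) * v

section
variable {G : Type*} [Group G] {u v : G}

theorem zpow_mul_zpow_eq (hu : u ^ 1024 = 1) (hv : v ^ 32 = 1) {x y x' y' : ℤ}
    (hx : (1024 : ℤ) ∣ x - x') (hy : (32 : ℤ) ∣ y - y') : u ^ x * v ^ y = u ^ x' * v ^ y' := by
  obtain ⟨m, hm⟩ := hx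
  obtain ⟨n, hn⟩ := hy
  have hu' : u ^ (1024 : ℤ) = 1 := by exact_mod_cast hu
  have hv' : v ^ (32 : ℤ) = 1 := by exact_mod_cast hv
  rw [show x = x' + 1024 * m by omega, show y = y' + 32 * n by omega, zpow_add, zpow_add, zpow_mul,
    zpow_mul, hu', hv', one_zpow, one_zpow, mul_one, mul_one]

theorem zpow_mul_zpow_mul (h : Commute u v) (x y x' y' : ℤ) :
    u ^ x * v ^ y * (u ^ x' * v ^ y') = u ^ (x + x') * v ^ (y + y') := by
  have := (h.zpow_zpow x' y).eq
  rw [zpow_add, zpow_add, mul_assoc, ← mul_assoc (v ^ y), ← this]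
  simp only [mul_assoc]

theorem zpow_mul_zpow_zpow (h : Commute u v) (x y n : ℤ) :
    (u ^ x * v ^ y) ^ n = u ^ (x * n) * v ^ (y * n) := by
  rw [(h.zpow_zpow x y).mul_zpow, zpow_mul, zpow_mul]

theorem ActsBy.conj (h : Commute u v) {g : G} {i j k : ℤ} (hg : ActsBy u v g i j k) (x y : ℤ) :
    g⁻¹ * (u ^ x * v ^ y) * g =
      u ^ ((1 + 16 * k - 32 * j + 512 * j * k) * x + (512 * i + 64 * k) * y) *
        v ^ (12 * k * x + y) := by
  have e : g⁻¹ * (u ^ x * v ^ y) * g = (g⁻¹ * u * g) ^ x * (g⁻¹ * v * g) ^ y := by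
    have := conj_zpow (a := g⁻¹) (b := u) (i := x)
    have h2 := conj_zpow (a := g⁻¹) (b := v) (i := y)
    rw [inv_inv] at this h2
    rw [this, h2]
    group
  have h3 := zpow_mul_zpow_zpow h (512 * i + 64 * k) 1 y
  rw [zpow_one] at h3
  rw [e, hg.left, hg.right, zpow_mul_zpow_zpow h, h3, zpow_mul_zpow_mul h, one_mul]

/-- The parameters add because `16² + 12 * 64 = 1024` removes the quadratic terms in `k, k'`. The
cross terms `-512 (j k' + j' k)` agree with those of `512 (j + j') (k + k')` modulo 1024. The
witnesses are the quotients by 1024 and 32. -/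
theorem ActsBy.mul (h : Commute u v) (hu : u ^ 1024 = 1) (hv : v ^ 32 = 1) {g g' : G}
    {i j k i' j' k' : ℤ} (hg : ActsBy u v g i j k) (hg' : ActsBy u v g' i' j' k') :
    ActsBy u v (g * g') (i + i') (j + j') (k + k') where
  left := by
    rw [show (g * g')⁻¹ * u * (g * g') = g'⁻¹ * (g⁻¹ * u * g) * g' by group, hg.left, hg'.conj h]
    refine zpow_mul_zpow_eq hu hv ?_ ?_
    · exact ⟨k * k' - (j * k' + j' * k) + j * j' + 8 * k * k' * (j + j') - 16 * j * j' * (k + k') +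
        256 * j * k * j' * k' + 6 * i' * k, by ring⟩
    · exact ⟨6 * k' * k - 12 * k' * j + 192 * k' * j * k, by ring⟩
  right := by
    rw [show (g * g')⁻¹ * v * (g * g') = g'⁻¹ * (g⁻¹ * v * g) * g' by group, hg.right]
    have := hg'.conj h (512 * i + 64 * k) 1
    rw [zpow_one] at this
    rw [this]
    conv_rhs => rw [← zpow_one v]
    refine zpow_mul_zpow_eq hu hv ?_ ?_
    · exact ⟨(k' - 2 * j' + 32 * j' * k') * (8 * i + k), by ring⟩
    · exact ⟨24 * k' * (8 * i + k), by ring⟩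

theorem ActsBy.inv (h : Commute u v) (hu : u ^ 1024 = 1) (hv : v ^ 32 = 1) {g : G}
    {i j k : ℤ} (hg : ActsBy u v g i j k) : ActsBy u v g⁻¹ (-i) (-j) (-k) where
  left := by
    have e : g⁻¹ * (u ^ (1 + 16 * -k - 32 * -j + 512 * -j * -k) * v ^ (12 * -k)) * g =
        u ^ (1 : ℤ) * v ^ (0 : ℤ) := by
      rw [hg.conj h]
      refine zpow_mul_zpow_eq hu hv ?_ ?_
      · exact ⟨2 * j * k + 256 * j ^ 2 * k ^ 2 - k ^ 2 - j ^ 2 - 6 * i * k, by ring⟩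
      · exact ⟨6 * k * (-k + 2 * j + 32 * j * k), by ring⟩
    rw [zpow_one, zpow_zero, mul_one] at e
    rw [inv_inv, mul_inv_eq_iff_eq_mul]
    nth_rw 1 [← e]
    group
  right := by
    have e : g⁻¹ * (u ^ (512 * -i + 64 * -k) * v ^ (1 : ℤ)) * g = u ^ (0 : ℤ) * v ^ (1 : ℤ) := by
      rw [hg.conj h]
      refine zpow_mul_zpow_eq hu hv ?_ ?_
      · exact ⟨-(k - 2 * j + 32 * j * k) * (8 * i + k), by ring⟩
      · exact ⟨-24 * k * (8 * i + k), by ring⟩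
    rw [zpow_one, zpow_zero, one_mul] at e
    rw [inv_inv, mul_inv_eq_iff_eq_mul]
    nth_rw 1 [← e]
    group

theorem ActsBy.comm (h : Commute u v) {g : G} {i j k : ℤ} (hg : ActsBy u v g i j k) (x y : ℤ) :
    comm (u ^ x * v ^ y) g =
      u ^ ((16 * k - 32 * j + 512 * j * k) * x + (512 * i + 64 * k) * y) * v ^ (12 * k * x) := by
  have e : PowerfulEngel.comm (u ^ x * v ^ y) g =
    (u ^ x * v ^ y)⁻¹ * (g⁻¹ * (u ^ x * v ^ y) * g) := by simp [PowerfulEngel.comm, mul_assoc]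
  rw [e, hg.conj h, inv_mul_eq_iff_eq_mul, zpow_mul_zpow_mul h]
  congr 2 <;> ring

/-- The matrix of `g - 1` on exponents squares to zero modulo the orders of `u` and `v`, again
through `16² + 12 * 64 = 1024`. This is the source of the Engel identity. -/
theorem ActsBy.comm_comm (h : Commute u v) (hu : u ^ 1024 = 1) (hv : v ^ 32 = 1) {g : G}
    {i j k : ℤ} (hg : ActsBy u v g i j k) (x y : ℤ) :
    PowerfulEngel.comm (PowerfulEngel.comm (u ^ x * v ^ y) g) g = 1 := by
  rw [hg.comm h, hg.comm h]
  refine Eq.trans (b := u ^ (0 : ℤ) * v ^ (0 : ℤ)) ?_ (by simp)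
  refine zpow_mul_zpow_eq hu hv ?_ ?_
  · exact ⟨x * (k ^ 2 + j ^ 2 + 256 * j ^ 2 * k ^ 2 - k * j + 16 * j * k ^ 2 - 32 * j ^ 2 * k) +
      6 * i * k * x + (k - 2 * j + 32 * j * k) * (8 * i + k) * y, by ring⟩
  · exact ⟨6 * k * (k - 2 * j + 32 * j * k) * x + 24 * k * (8 * i + k) * y, by ring⟩

end

/-! ### The explicit 2-group: finiteness, rank, Engel identity and class -/

namespace ExampleGroup

/-- The first generator of the explicit group. -/
def a : ExampleGroup := PresentedGroup.of 0
/-- The second generator of the explicit group. -/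
def b : ExampleGroup := PresentedGroup.of 1
/-- The third generator of the explicit group. -/
def c : ExampleGroup := PresentedGroup.of 2

theorem closure_eq_top : Subgroup.closure {a, b, c} = (⊤ : Subgroup ExampleGroup) := by
  rw [← PresentedGroup.closure_range_of]
  congr 1
  ext x
  simp [Fin.exists_fin_succ, a, b, c, eq_comm]

/-- The defining relations of the explicit group. -/
def Relations {G : Type*} [Group G] (a b c : G) : Prop :=
  comm a b = (a ^ 2 ^ 5)⁻¹ ∧
  comm a c = b ^ (3 * 2 ^ 6) * a ^ 2 ^ 4 ∧
  comm b c = b ^ 2 ^ 7 * a ^ 2 ^ 2 ∧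
  comm (a ^ 2 ^ 2) (b ^ 2 ^ 6) = 1 ∧
  comm (a ^ 2 ^ 2) b = (a ^ 2 ^ 7)⁻¹ ∧
  comm (a ^ 2 ^ 2) c = (a ^ 2 ^ 2)⁻¹ * b ^ (3 * 2 ^ 8) * a ^ (17 * 2 ^ 2) ∧
  comm (b ^ 2 ^ 6) a = a ^ 2 ^ 11 ∧
  comm (b ^ 2 ^ 6) c = a ^ 2 ^ 8 ∧
  a ^ 2 ^ 12 = 1 ∧ b ^ 2 ^ 11 = 1 ∧ c ^ 2 ^ 10 = 1

theorem forall_map_eq_one_iff {G : Type*} [Group G] (f : FreeGroup (Fin 3) →* G) :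
    (∀ w ∈ exampleRels, f w = 1) ↔ Relations (f genA) (f genB) (f genC) := by
  simp only [exampleRels, Relations, Set.forall_mem_insert, Set.mem_singleton_iff, forall_eq,
    map_mul, map_inv, map_pow, map_comm, mul_inv_eq_one]

theorem relations : Relations a b c :=
  (forall_map_eq_one_iff (PresentedGroup.mk exampleRels)).1 fun _ hw => PresentedGroup.one_of_mem hw

/-- The element `a ^ 4`. -/
def u : ExampleGroup := a ^ 2 ^ 2
/-- The element `b ^ 64`. -/
def v : ExampleGroup := b ^ 2 ^ 6

theorem a_pow (m n : ℕ) (h : m = 2 ^ 2 * n) : a ^ m = u ^ n := by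
  rw [h, pow_mul, u]

theorem b_pow (m n : ℕ) (h : m = 2 ^ 6 * n) : b ^ m = v ^ n := by
  rw [h, pow_mul, v]

theorem u_pow : u ^ 1024 = 1 := by
  rw [← a_pow (2 ^ 12) 1024 rfl]
  exact relations.2.2.2.2.2.2.2.2.1

theorem v_pow : v ^ 32 = 1 := by
  rw [← b_pow (2 ^ 11) 32 rfl]
  exact relations.2.2.2.2.2.2.2.2.2.1

theorem conj_eq {G : Type*} [Group G] {x g z : G} (h : comm x g = z) : g⁻¹ * x * g = x * z := by
  rw [← h]
  simp [comm, mul_assoc]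

theorem commute_u_v : Commute u v := by
  have h := conj_eq relations.2.2.2.1
  rw [mul_one, mul_assoc, inv_mul_eq_iff_eq_mul] at h
  exact h

theorem actsBy_a : ActsBy u v a 1 0 0 where
  left := by
    have : Commute u a := (Commute.refl a).pow_left _
    simp [mul_assoc, this.eq]
  right := by
    have h := conj_eq relations.2.2.2.2.2.2.1
    rw [a_pow (2 ^ 11) 512 rfl, ← v, ((commute_u_v.pow_left 512).eq).symm] at h
    rw [h]
    norm_num

theorem actsBy_b : ActsBy u v b 0 1 0 where
  left := by
    have h := conj_eq relations.2.2.2.2.1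
    rw [a_pow (2 ^ 7) 32 rfl, ← u] at h
    rw [h]
    norm_num
    group
  right := by
    have : Commute v b := (Commute.refl b).pow_left _
    simp [mul_assoc, this.eq]

theorem actsBy_c : ActsBy u v c 0 0 1 where
  left := by
    have h := conj_eq relations.2.2.2.2.2.1
    rw [a_pow (17 * 2 ^ 2) 17 (by norm_num), b_pow (3 * 2 ^ 8) 12 (by norm_num), ← u] at h
    rw [h, mul_assoc, mul_inv_cancel_left, ((commute_u_v.pow_pow 17 12).eq).symm]
    norm_num
  right := by
    have h := conj_eq relations.2.2.2.2.2.2.2.1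
    rw [a_pow (2 ^ 8) 64 rfl, ← v, ((commute_u_v.pow_left 64).eq).symm] at h
    rw [h]
    norm_num

theorem exists_actsBy (g : ExampleGroup) : ∃ i j k, ActsBy u v g i j k := by
  have hg : g ∈ Subgroup.closure {a, b, c} := closure_eq_top ▸ Subgroup.mem_top g
  induction hg using Subgroup.closure_induction with
  | mem x hx =>
    rcases hx with rfl | rfl | rfl
    · exact ⟨_, _, _, actsBy_a⟩
    · exact ⟨_, _, _, actsBy_b⟩
    · exact ⟨_, _, _, actsBy_c⟩
  | one => exact ⟨0, 0, 0, by simp, by simp⟩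
  | mul x y _ _ hx hy =>
    obtain ⟨i, j, k, hx⟩ := hx
    obtain ⟨i', j', k', hy⟩ := hy
    exact ⟨_, _, _, hx.mul commute_u_v u_pow v_pow hy⟩
  | inv x _ hx =>
    obtain ⟨i, j, k, hx⟩ := hx
    exact ⟨_, _, _, hx.inv commute_u_v u_pow v_pow⟩

/-- The abelian normal subgroup generated by `a ^ 4` and `b ^ 64`. -/
def base : Subgroup ExampleGroup where
  carrier := {g | ∃ x y : ℤ, g = u ^ x * v ^ y}
  one_mem' := ⟨0, 0, by simp⟩
  mul_mem' := by
    rintro _ _ ⟨x, y, rfl⟩ ⟨x', y', rfl⟩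
    exact ⟨_, _, zpow_mul_zpow_mul commute_u_v x y x' y'⟩
  inv_mem' := by
    rintro _ ⟨x, y, rfl⟩
    exact ⟨_, _, (zpow_neg_one _).symm.trans (zpow_mul_zpow_zpow commute_u_v x y (-1))⟩

instance : base.Normal where
  conj_mem := by
    rintro _ ⟨x, y, rfl⟩ g
    obtain ⟨i, j, k, h⟩ := exists_actsBy g⁻¹
    have := h.conj commute_u_v x y
    rw [inv_inv] at this
    exact ⟨_, _, this⟩

theorem u_mem : u ∈ base := ⟨1, 0, by simp⟩
theorem v_mem : v ∈ base := ⟨0, 1, by simp⟩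

theorem comm_mem_iff_commute {G : Type*} [Group G] {N : Subgroup G} [N.Normal] {x y : G} :
    comm x y ∈ N ↔ Commute (x : G ⧸ N) (y : G ⧸ N) := by
  have e : comm x y = (y * x)⁻¹ * (x * y) := by simp [comm, mul_assoc]
  rw [e, ← QuotientGroup.eq, eq_comm]
  rfl

theorem comm_mem_of_closure_eq_top {G : Type*} [Group G] {N : Subgroup G} [N.Normal] {S : Set G}
    (hS : Subgroup.closure S = ⊤) (h : ∀ x ∈ S, ∀ y ∈ S, comm x y ∈ N) (x y : G) :
    comm x y ∈ N := by
  have hx : x ∈ Subgroup.closure S := hS ▸ Subgroup.mem_top x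
  have hy : y ∈ Subgroup.closure S := hS ▸ Subgroup.mem_top y
  rw [comm_mem_iff_commute]
  induction hx, hy using Subgroup.closure_induction₂ with
  | mem x y hx hy => exact comm_mem_iff_commute.1 (h x hx y hy)
  | one_left => exact Commute.one_left _
  | one_right => exact Commute.one_right _
  | mul_left _ _ _ _ _ _ h1 h2 => exact h1.mul_left h2
  | mul_right _ _ _ _ _ _ h1 h2 => exact h1.mul_right h2
  | inv_left _ _ _ _ h1 => exact h1.inv_left
  | inv_right _ _ _ _ h1 => exact h1.inv_right

theorem comm_self {G : Type*} [Group G] (x : G) : comm x x = 1 := by simp [comm]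

theorem comm_swap {G : Type*} [Group G] (x y : G) : comm y x = (comm x y)⁻¹ := by
  simp [comm, mul_assoc]

theorem comm_mem_base (x y : ExampleGroup) : comm x y ∈ base := by
  have hab : comm a b ∈ base := by
    rw [relations.1, a_pow (2 ^ 5) 8 rfl]
    exact inv_mem (pow_mem u_mem _)
  have hac : comm a c ∈ base := by
    rw [relations.2.1, a_pow (2 ^ 4) 4 rfl, b_pow (3 * 2 ^ 6) 3 (by norm_num)]
    exact mul_mem (pow_mem v_mem _) (pow_mem u_mem _)
  have hbc : comm b c ∈ base := by
    rw [relations.2.2.1, b_pow (2 ^ 7) 2 rfl]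
    exact mul_mem (pow_mem v_mem _) u_mem
  refine comm_mem_of_closure_eq_top closure_eq_top ?_ x y
  rintro x (rfl | rfl | rfl) y (rfl | rfl | rfl)
  · rw [comm_self]; exact one_mem _
  · exact hab
  · exact hac
  · rw [comm_swap]; exact inv_mem hab
  · rw [comm_self]; exact one_mem _
  · exact hbc
  · rw [comm_swap]; exact inv_mem hac
  · rw [comm_swap]; exact inv_mem hbc
  · rw [comm_self]; exact one_mem _

theorem pow_mem_base (g : ExampleGroup) : g ^ 1024 ∈ base := by
  have hg : g ∈ Subgroup.closure {a, b, c} := closure_eq_top ▸ Subgroup.mem_top g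
  rw [← QuotientGroup.eq_one_iff, QuotientGroup.mk_pow]
  induction hg using Subgroup.closure_induction with
  | mem x hx =>
    rw [← QuotientGroup.mk_pow, QuotientGroup.eq_one_iff]
    rcases hx with rfl | rfl | rfl
    · rw [a_pow 1024 256 rfl]
      exact pow_mem u_mem _
    · rw [b_pow 1024 16 rfl]
      exact pow_mem v_mem _
    · have h : c ^ 1024 = 1 := relations.2.2.2.2.2.2.2.2.2.2
      rw [h]
      exact one_mem _
  | one => simp
  | mul x y _ _ hx hy =>
    rw [QuotientGroup.mk_mul, (comm_mem_iff_commute.1 (comm_mem_base x y)).mul_pow, hx, hy, one_mul]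
  | inv x _ hx => rw [QuotientGroup.mk_inv, inv_pow, hx, inv_one]

theorem pow_eq_one_of_mem_base {g : ExampleGroup} (hg : g ∈ base) : g ^ 1024 = 1 := by
  obtain ⟨x, y, rfl⟩ := hg
  have hv : v ^ 1024 = 1 := by rw [show 1024 = 32 * 32 by norm_num, pow_mul, v_pow, one_pow]
  rw [(commute_u_v.zpow_zpow x y).mul_pow, ← zpow_natCast, ← zpow_natCast (v ^ y), zpow_comm,
    zpow_comm v, zpow_natCast, zpow_natCast, u_pow, hv, one_zpow, one_zpow, one_mul]

open scoped Pointwise in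
instance : Finite base := by
  have hu : IsOfFinOrder u := isOfFinOrder_iff_pow_eq_one.2 ⟨1024, by norm_num, u_pow⟩
  have hv : IsOfFinOrder v := isOfFinOrder_iff_pow_eq_one.2 ⟨32, by norm_num, v_pow⟩
  have h1 : ((Subgroup.zpowers u : Set ExampleGroup) *
      (Subgroup.zpowers v : Set ExampleGroup)).Finite :=
    (finite_zpowers.2 hu).mul (finite_zpowers.2 hv)
  refine (h1.subset ?_).to_subtype
  rintro _ ⟨x, y, rfl⟩
  exact Set.mul_mem_mul ⟨x, rfl⟩ ⟨y, rfl⟩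

instance : Finite (ExampleGroup ⧸ base) := by
  let : CommGroup (ExampleGroup ⧸ base) :=
    { (inferInstance : Group (ExampleGroup ⧸ base)) with
      mul_comm := fun x y => by
        obtain ⟨x, rfl⟩ := QuotientGroup.mk_surjective x
        obtain ⟨y, rfl⟩ := QuotientGroup.mk_surjective y
        exact comm_mem_iff_commute.1 (comm_mem_base x y) }
  have : Group.FG ExampleGroup :=
    Group.fg_iff.2 ⟨{a, b, c}, closure_eq_top, by simp⟩
  -- The quotient is abelian, finitely generated and of exponent dividing 1024.
  refine CommGroup.finite_of_fg_isMulTorsion _ fun x => ?_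
  obtain ⟨x, rfl⟩ := QuotientGroup.mk_surjective x
  refine isOfFinOrder_iff_pow_eq_one.2 ⟨1024, by norm_num, ?_⟩
  exact (QuotientGroup.eq_one_iff _).2 (pow_mem_base x)

instance : Finite ExampleGroup := Finite.of_subgroup_quotient base

/-- All exponents in the relations are even, so the relations hold in any elementary abelian 2-group
and the three generators stay independent there. -/
theorem hasBasisMod : HasBasisMod 2 (Fin 3) ExampleGroup := by
  have hr : ∀ x y z : Multiplicative (Fin 3 → ZMod 2), Relations x y z := by
    intro x y z
    have hc : ∀ x y : Multiplicative (Fin 3 → ZMod 2), comm x y = 1 := fun x y => by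
      simp [comm, mul_comm]
    have hp : ∀ (x : Multiplicative (Fin 3 → ZMod 2)) {n : ℕ} (k : ℕ), n = 2 * k → x ^ n = 1 := by
      rintro x _ k rfl
      rw [pow_mul, pow_eq_one_of_zmod, one_pow]
    simp only [Relations, hc]
    rw [hp x (n := 2 ^ 5) (2 ^ 4) rfl, hp x (n := 2 ^ 4) (2 ^ 3) rfl, hp x (n := 2 ^ 2) 2 rfl,
      hp x (n := 2 ^ 7) (2 ^ 6) rfl, hp x (n := 17 * 2 ^ 2) 34 rfl, hp x (n := 2 ^ 11) (2 ^ 10) rfl,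
      hp x (n := 2 ^ 8) (2 ^ 7) rfl, hp x (n := 2 ^ 12) (2 ^ 11) rfl,
      hp y (n := 3 * 2 ^ 6) 96 rfl, hp y (n := 2 ^ 7) (2 ^ 6) rfl, hp y (n := 3 * 2 ^ 8) 384 rfl,
      hp y (n := 2 ^ 11) (2 ^ 10) rfl, hp z (n := 2 ^ 10) (2 ^ 9) rfl]
    simp
  have h := (forall_map_eq_one_iff (FreeGroup.lift fun i : Fin 3 =>
    (Multiplicative.ofAdd (Pi.single i 1) : Multiplicative (Fin 3 → ZMod 2)))).2 (hr _ _ _)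
  refine ⟨PresentedGroup.of, PresentedGroup.toGroup h, PresentedGroup.closure_range_of _,
    fun i => ?_⟩
  exact PresentedGroup.toGroup.of h

theorem isPowerfulMetabelianThreeEngel : IsPowerfulMetabelianThreeEngel 2 3 ExampleGroup := by
  refine ⟨⟨fun g => ⟨20, ?_⟩, ?_⟩, ?_, ?_, ?_⟩
  · rw [show 2 ^ 20 = 1024 * 1024 by norm_num, pow_mul]
    exact pow_eq_one_of_mem_base (pow_mem_base g)
  · rw [if_pos rfl]
    refine commutator_le_of_comm_mem fun x y => ?_
    obtain ⟨m, n, h⟩ := comm_mem_base x y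
    rw [h]
    refine mul_mem (zpow_mem (pow_mem_powerSubgroup a 4) m) (zpow_mem ?_ n)
    -- Both generators of `base` are fourth powers: `u = a ^ 4` and `v = (b ^ 16) ^ 4`.
    rw [v, show 2 ^ 6 = 16 * 4 by norm_num, pow_mul]
    exact pow_mem_powerSubgroup _ 4
  · refine isMetabelian_of_comm_mem comm_mem_base ?_
    rintro _ ⟨x, y, rfl⟩ _ ⟨x', y', rfl⟩
    rw [zpow_mul_zpow_mul commute_u_v, zpow_mul_zpow_mul commute_u_v, add_comm x, add_comm y]
  · rw [isEngel_three_iff]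
    intro x y
    obtain ⟨m, n, h⟩ := comm_mem_base y x
    obtain ⟨i, j, k, hx⟩ := exists_actsBy x
    rw [h]
    exact hx.comm_comm commute_u_v u_pow v_pow m n
  · have : Fact (Nat.Prime 2) := ⟨Nat.prime_two⟩
    rw [hasBasisMod.rank_eq, Fintype.card_fin]

/-- From `[b,c] = u v²`, commuting with `b` gives `u^(-32)`, and then with `c` gives `u^(-512)
v^(-384) = u^512 = a^(2^11)`. -/
theorem comm_comm_comm_ne_one : comm (comm (comm b c) b) c ≠ 1 := by
  intro h
  have e : comm b c = u ^ (1 : ℤ) * v ^ (2 : ℤ) := by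
    rw [relations.2.2.1, b_pow (2 ^ 7) 2 rfl, ← u, ((commute_u_v.pow_right 2).eq).symm]
    norm_cast
  rw [e, actsBy_b.comm commute_u_v, actsBy_c.comm commute_u_v] at h
  have h2 : u ^ (512 : ℤ) * v ^ (0 : ℤ) = 1 := by
    rw [← h]
    exact zpow_mul_zpow_eq u_pow v_pow (by norm_num) (by norm_num)
  rw [zpow_zero, mul_one] at h2
  have h3 : u ^ 512 = 1 := by exact_mod_cast h2
  rw [← a_pow (2 ^ 11) 512 rfl] at h3
  exact of_pow_ne_one h3

theorem classEq_four : ClassEq 4 ExampleGroup := by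
  refine classEq_succ ((upper_bounds 2 3 _ Nat.prime_two isPowerfulMetabelianThreeEngel).2 rfl) ?_
  intro h
  have h1 : b ∈ Subgroup.upperCentralSeries ExampleGroup 3 := h ▸ Subgroup.mem_top _
  have h2 := mem_upperCentralSeries_succ_iff_comm.1 (mem_upperCentralSeries_succ_iff_comm.1
    (mem_upperCentralSeries_succ_iff_comm.1 h1 c) b) c
  rw [Subgroup.upperCentralSeries_zero, Subgroup.mem_bot] at h2
  exact comm_comm_comm_ne_one h2

end ExampleGroup

/-! ### Arbitrary rank for `p = 2` and the final statement -/

theorem exists_class_four (r : ℕ) (hr : 3 ≤ r) :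
    ∃ (G : Type) (_ : Group G) (_ : Finite G),
      IsPowerfulMetabelianThreeEngel 2 r G ∧ ClassEq 4 G := by
  have : Fact (Nat.Prime 2) := ⟨Nat.prime_two⟩
  obtain ⟨k, rfl⟩ := Nat.exists_eq_add_of_le hr
  exact ⟨ExampleGroup × Multiplicative (Fin k → ZMod 2), inferInstance, inferInstance,
    ExampleGroup.isPowerfulMetabelianThreeEngel.prod ExampleGroup.hasBasisMod,
    ExampleGroup.classEq_four.prod_comm (by norm_num)⟩

end PowerfulEngel

theorem theorem1p3 :
    -- the upper bounds
    (∀ (p r : ℕ) (G : Type u) [Group G] [Finite G], p.Prime → 3 ≤ r →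
      PowerfulEngel.IsPowerfulMetabelianThreeEngel p r G →
        (Odd p → PowerfulEngel.ClassAtMost 3 G) ∧ (p = 2 → PowerfulEngel.ClassAtMost 4 G)) ∧
    -- both bounds are attained, for every prime and every rank
    (∀ p r : ℕ, p.Prime → Odd p → 3 ≤ r →
      ∃ (G : Type) (_ : Group G) (_ : Finite G),
        PowerfulEngel.IsPowerfulMetabelianThreeEngel p r G ∧ PowerfulEngel.ClassEq 3 G) ∧
    (∀ r : ℕ, 3 ≤ r →
      ∃ (G : Type) (_ : Group G) (_ : Finite G),
        PowerfulEngel.IsPowerfulMetabelianThreeEngel 2 r G ∧ PowerfulEngel.ClassEq 4 G) ∧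
    -- the explicit presentation
    (∃ _ : Finite PowerfulEngel.ExampleGroup,
      PowerfulEngel.IsPowerfulMetabelianThreeEngel 2 3 PowerfulEngel.ExampleGroup ∧
        PowerfulEngel.ClassEq 4 PowerfulEngel.ExampleGroup) :=
  ⟨fun p r G _ _ hp _ h => PowerfulEngel.upper_bounds p r G hp h,
    PowerfulEngel.exists_class_three,
    PowerfulEngel.exists_class_four,
    inferInstance, PowerfulEngel.ExampleGroup.isPowerfulMetabelianThreeEngel,
    PowerfulEngel.ExampleGroup.classEq_four⟩
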